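/- Let $\mathcal D$ be the usual lattice of dyadic intervals on $\mathbb R$. Call $I\in\mathcal D$ even if $|I|=2^{-2k}$ for some $k\in\mathbb Z$. Write $I_+$ and $I_-$ for the right and left halves of $I$, and let $h_I=|I|^{-1/2}(\mathbf 1_{I_+}-\mathbf 1_{I_-})$ be its Haar function. Let $T_1$ be the dyadic shift acting in the variable $x$ of functions $f(x,y)$ on $\mathbb R^2$, given by $$T_1h_I=h_{I_+}-h_{I_-}\ \text{ if } I \text{ is even},\qquad T_1h_I=0\ \text{ otherwise},$$ and let $T_2$ be its copy acting in the variable $y$. For a real-valued locally integrable function $b$ on $\mathbb R^2$ (also denoting multiplication by $b$) let $[T_2,[T_1,b]]$ be the repeated commutator, and let $\|[T_2,[T_1,b]]\|\in[0,\infty]$ be its norm on $L^2(\mathbb R^2)$, that is, the supremum of $|([T_2,[T_1,b]]f,g)|$ over finite linear combinations $f,g$ of the functions $h_I\otimes h_J$, $I,J\in\mathcal D$, with $\|f\|_2\le 1$ and $\|g\|_2\le1$. A dyadic open set is a finite union of dyadic rectangles $I\times J$, $I,J\in\mathcal D$. There is an absolute constant $C_1<\infty$ such that the following holds. Suppose that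 $b$ skips scales, i.e. $(b,h_I\otimes h_J)\ne0$ only if $I$ and $J$ are both even. Then for every dyadic open set $U_0$ $$\sum_{I\times J\subset U_0}(b,h_I\otimes h_J)^2\le C_1\,\|[T_2,[T_1,b]]\|^2\,|U_0| .$$ Consequently, the dyadic Chang–Fefferman norm $$\|b\|_{BMO_{ChF}}=\Big(\sup_{U}\frac1{|U|}\sum_{I\times J\subset U}(b,h_I\otimes h_J)^2\Big)^{1/2},$$ where $U$ runs over all non-empty dyadic open sets, satisfies $\|b\|_{BMO_{ChF}}^2\le C_1\|[T_2,[T_1,b]]\|^2$. -/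

import Mathlib

open MeasureTheory
open scoped ENNReal NNReal

noncomputable section

/-- The dyadic interval `[m 2⁻ᵏ, (m+1) 2⁻ᵏ)` of the usual dyadic lattice on the line;
`scale` is `k` and `pos` is `m`. -/
@[ext]
structure DyadicInterval where
  scale : ℤ
  pos : ℤ

namespace DyadicInterval

/-- The length `2⁻ᵏ`. -/
def length (I : DyadicInterval) : ℝ := (2 : ℝ) ^ (-I.scale)

/-- The underlying set `[m 2⁻ᵏ, (m+1) 2⁻ᵏ)`. -/
def toSet (I : DyadicInterval) : Set ℝ :=
  Set.Ico ((I.pos : ℝ) * I.length) (((I.pos : ℝ) + 1) * I.length)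

/-- `I` is even when `|I| = 2^(-2k)` for an integer `k`; otherwise it is odd. -/
def IsEven (I : DyadicInterval) : Prop := Even I.scale

/-- The right half `I₊`. -/
def plus (I : DyadicInterval) : DyadicInterval := ⟨I.scale + 1, 2 * I.pos + 1⟩

/-- The left half `I₋`. -/
def minus (I : DyadicInterval) : DyadicInterval := ⟨I.scale + 1, 2 * I.pos⟩

/-- The dyadic parent `Î` (the division is rounded down). -/
def parent (I : DyadicInterval) : DyadicInterval := ⟨I.scale - 1, I.pos / 2⟩

open Classical in
/-- The sign `s(I, Î)`: `1` if `I = Î₊`, and `-1` otherwise. -/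
def sign (I : DyadicInterval) : ℝ := if I = I.parent.plus then 1 else -1

/-- The `L²`-normalized Haar function `h_I = |I|^(-1/2) (1_{I₊} - 1_{I₋})`. -/
def haar (I : DyadicInterval) (x : ℝ) : ℝ :=
  (Real.sqrt I.length)⁻¹ *
    (I.plus.toSet.indicator (fun _ => (1 : ℝ)) x - I.minus.toSet.indicator (fun _ => (1 : ℝ)) x)

end DyadicInterval

/-- A dyadic rectangle `I × J`. -/
abbrev DyadicRect : Type := DyadicInterval × DyadicInterval

namespace DyadicRect

/-- The underlying subset of the plane. -/
def toSet (R : DyadicRect) : Set (ℝ × ℝ) := R.1.toSet ×ˢ R.2.toSet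

/-- `h_R = h_I ⊗ h_J`. -/
def haar (R : DyadicRect) (p : ℝ × ℝ) : ℝ := R.1.haar p.1 * R.2.haar p.2

end DyadicRect

/-- The Haar coefficient `(b, h_R)`. -/
def haarCoeff (b : ℝ × ℝ → ℝ) (R : DyadicRect) : ℝ := ∫ p, b p * R.haar p

/-- Test functions: finite linear combinations `∑ c_R h_R` of the Haar functions `h_I ⊗ h_J`,
stored through their coefficients. -/
abbrev HaarPoly : Type := DyadicRect →₀ ℝ

/-- The function on the plane that a test function stands for. -/
def HaarPoly.eval (f : HaarPoly) (p : ℝ × ℝ) : ℝ := f.sum fun R c => c * R.haar p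

open Classical in
/-- The dyadic shift in the variable `x`:
`T₁ (h_I ⊗ h_J) = (h_{I₊} - h_{I₋}) ⊗ h_J` if `I` is even, and `0` otherwise. -/
def shift₁ : HaarPoly →ₗ[ℝ] HaarPoly :=
  Finsupp.linearCombination ℝ fun R : DyadicRect =>
    if R.1.IsEven then
      (Finsupp.single (R.1.plus, R.2) (1 : ℝ) - Finsupp.single (R.1.minus, R.2) 1 : HaarPoly)
    else 0

open Classical in
/-- The dyadic shift in the variable `y`:
`T₂ (h_I ⊗ h_J) = h_I ⊗ (h_{J₊} - h_{J₋})` if `J` is even, and `0` otherwise. -/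
def shift₂ : HaarPoly →ₗ[ℝ] HaarPoly :=
  Finsupp.linearCombination ℝ fun R : DyadicRect =>
    if R.2.IsEven then
      (Finsupp.single (R.1, R.2.plus) (1 : ℝ) - Finsupp.single (R.1, R.2.minus) 1 : HaarPoly)
    else 0

open Classical in
/-- The adjoint of `T₁`:
`T₁* (h_I ⊗ h_J) = s(I, Î) h_Î ⊗ h_J` if `Î` is even, and `0` otherwise. -/
def shiftAdj₁ : HaarPoly →ₗ[ℝ] HaarPoly :=
  Finsupp.linearCombination ℝ fun R : DyadicRect =>
    if R.1.parent.IsEven then (Finsupp.single (R.1.parent, R.2) R.1.sign : HaarPoly) else 0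

open Classical in
/-- The adjoint of `T₂`:
`T₂* (h_I ⊗ h_J) = s(J, Ĵ) h_I ⊗ h_Ĵ` if `Ĵ` is even, and `0` otherwise. -/
def shiftAdj₂ : HaarPoly →ₗ[ℝ] HaarPoly :=
  Finsupp.linearCombination ℝ fun R : DyadicRect =>
    if R.2.parent.IsEven then (Finsupp.single (R.1, R.2.parent) R.2.sign : HaarPoly) else 0

namespace DyadicInterval

theorem parent_plus (I : DyadicInterval) : I.plus.parent = I := by
  ext <;> simp [plus, parent]; omega

theorem parent_minus (I : DyadicInterval) : I.minus.parent = I := by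
  ext <;> simp [minus, parent]

theorem plus_ne_minus (I J : DyadicInterval) : I.plus ≠ J.minus := by
  intro h
  have h2 := congrArg DyadicInterval.pos h
  simp only [plus, minus] at h2
  omega

theorem eq_plus_or_eq_minus (I : DyadicInterval) : I = I.parent.plus ∨ I = I.parent.minus := by
  rcases Int.emod_two_eq_zero_or_one I.pos with h | h
  · right
    ext <;> simp only [minus, parent] <;> omega
  · left
    ext <;> simp only [plus, parent] <;> omega

end DyadicInterval

/-- The `L²` pairing of two test functions, in terms of their Haar coefficients. -/
def HaarPoly.pair (f g : HaarPoly) : ℝ := f.sum fun R c => c * g R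

theorem HaarPoly.pair_single_left (R : DyadicRect) (g : HaarPoly) :
    HaarPoly.pair (Finsupp.single R 1) g = g R := by
  simp [HaarPoly.pair]

theorem HaarPoly.pair_single_right (f : HaarPoly) (K : DyadicRect) :
    HaarPoly.pair f (Finsupp.single K 1) = f K := by
  classical
  simp +contextual [HaarPoly.pair, Finsupp.sum, Finsupp.single_apply, eq_comm]

theorem HaarPoly.pair_eq_apply (f g : HaarPoly) :
    HaarPoly.pair f g = Finsupp.linearCombination ℝ (fun R => g R) f := by
  simp [HaarPoly.pair, Finsupp.linearCombination_apply]

theorem HaarPoly.pair_comm (f g : HaarPoly) : HaarPoly.pair f g = HaarPoly.pair g f := by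
  classical
  unfold HaarPoly.pair
  rw [Finsupp.sum_of_support_subset f (Finset.subset_union_left (s₂ := g.support)) _ (by simp),
    Finsupp.sum_of_support_subset g (Finset.subset_union_right (s₁ := f.support)) _ (by simp)]
  exact Finset.sum_congr rfl fun R _ => mul_comm _ _

theorem HaarPoly.pair_adjoint_of_single (T T' : HaarPoly →ₗ[ℝ] HaarPoly)
    (key : ∀ R K : DyadicRect,
      HaarPoly.pair (T (Finsupp.single R 1)) (Finsupp.single K 1) =
        HaarPoly.pair (Finsupp.single R 1) (T' (Finsupp.single K 1))) (f g : HaarPoly) :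
    HaarPoly.pair (T f) g = HaarPoly.pair f (T' g) := by
  have addl : ∀ u v w : HaarPoly, HaarPoly.pair (u + v) w = HaarPoly.pair u w + HaarPoly.pair v w :=
    fun u v w => by simp [HaarPoly.pair_eq_apply]
  have smull : ∀ (c : ℝ) (u w : HaarPoly), HaarPoly.pair (c • u) w = c * HaarPoly.pair u w :=
    fun c u w => by simp [HaarPoly.pair_eq_apply]
  have zerol : ∀ w : HaarPoly, HaarPoly.pair 0 w = 0 := fun w => by simp [HaarPoly.pair]
  induction f using Finsupp.induction_linear with
  | zero => rw [map_zero, zerol, zerol]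
  | add u v hu hv => rw [map_add, addl, addl, hu, hv]
  | single R c =>
    rw [← mul_one c, ← smul_eq_mul, ← Finsupp.smul_single, map_smul, smull, smull]
    congr 1
    induction g using Finsupp.induction_linear with
    | zero => rw [map_zero, HaarPoly.pair_comm, zerol, HaarPoly.pair_comm, zerol]
    | add u v hu hv =>
      rw [map_add, HaarPoly.pair_comm, addl, HaarPoly.pair_comm u, HaarPoly.pair_comm v, hu, hv,
        HaarPoly.pair_comm _ (T' u + T' v), addl, HaarPoly.pair_comm (T' u),
        HaarPoly.pair_comm (T' v)]
    | single K d =>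
      rw [← mul_one d, ← smul_eq_mul, ← Finsupp.smul_single, map_smul, HaarPoly.pair_comm, smull,
        HaarPoly.pair_comm _ (d • _), smull, HaarPoly.pair_comm, key, HaarPoly.pair_comm]

/-- `shiftAdj₁` is the adjoint of `shift₁`. -/
theorem pair_shift₁ (f g : HaarPoly) :
    HaarPoly.pair (shift₁ f) g = HaarPoly.pair f (shiftAdj₁ g) := by
  classical
  have key : ∀ R K : DyadicRect,
      HaarPoly.pair (shift₁ (Finsupp.single R 1)) (Finsupp.single K 1) =
        HaarPoly.pair (Finsupp.single R 1) (shiftAdj₁ (Finsupp.single K 1)) := by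
    rintro ⟨I, J⟩ ⟨K, L⟩
    rw [HaarPoly.pair_single_left, HaarPoly.pair_single_right]
    simp only [shift₁, shiftAdj₁, Finsupp.linearCombination_single, one_smul]
    rcases K.eq_plus_or_eq_minus with h | h
    · obtain ⟨P, rfl⟩ : ∃ P, K = DyadicInterval.plus P := ⟨_, h⟩
      by_cases hP : I = P
      · subst hP
        by_cases he : I.IsEven <;> by_cases hJ : J = L <;>
          simp [he, hJ, eq_comm (a := L) (b := J), DyadicInterval.parent_plus, DyadicInterval.sign,
            (DyadicInterval.plus_ne_minus _ _).symm]
      · have hP' : I.plus ≠ P.plus := fun h' => hP (by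
          simpa [DyadicInterval.parent_plus] using congrArg DyadicInterval.parent h')
        by_cases he : I.IsEven <;> by_cases he' : P.IsEven <;>
          simp [he, he', hP', DyadicInterval.parent_plus,
            (DyadicInterval.plus_ne_minus _ _).symm, Ne.symm hP]
    · obtain ⟨P, rfl⟩ : ∃ P, K = DyadicInterval.minus P := ⟨_, h⟩
      by_cases hP : I = P
      · subst hP
        by_cases he : I.IsEven <;> by_cases hJ : J = L <;>
          simp [he, hJ, eq_comm (a := L) (b := J), DyadicInterval.parent_minus, DyadicInterval.sign,
            (DyadicInterval.plus_ne_minus _ _).symm]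
      · have hP' : I.minus ≠ P.minus := fun h' => hP (by
          simpa [DyadicInterval.parent_minus] using congrArg DyadicInterval.parent h')
        by_cases he : I.IsEven <;> by_cases he' : P.IsEven <;>
          simp [he, he', hP', DyadicInterval.parent_minus,
            DyadicInterval.plus_ne_minus, Ne.symm hP]
  refine HaarPoly.pair_adjoint_of_single _ _ key f g

/-- `shiftAdj₂` is the adjoint of `shift₂`. -/
theorem pair_shift₂ (f g : HaarPoly) :
    HaarPoly.pair (shift₂ f) g = HaarPoly.pair f (shiftAdj₂ g) := by
  classical
  have key : ∀ R K : DyadicRect,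
      HaarPoly.pair (shift₂ (Finsupp.single R 1)) (Finsupp.single K 1) =
        HaarPoly.pair (Finsupp.single R 1) (shiftAdj₂ (Finsupp.single K 1)) := by
    rintro ⟨I, J⟩ ⟨K, L⟩
    rw [HaarPoly.pair_single_left, HaarPoly.pair_single_right]
    simp only [shift₂, shiftAdj₂, Finsupp.linearCombination_single, one_smul]
    rcases L.eq_plus_or_eq_minus with h | h
    · obtain ⟨P, rfl⟩ : ∃ P, L = DyadicInterval.plus P := ⟨_, h⟩
      by_cases hP : J = P
      · subst hP
        by_cases he : J.IsEven <;> by_cases hJ : I = K <;>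
          simp [he, hJ, eq_comm (a := K) (b := I), DyadicInterval.parent_plus, DyadicInterval.sign,
            (DyadicInterval.plus_ne_minus _ _).symm]
      · have hP' : J.plus ≠ P.plus := fun h' => hP (by
          simpa [DyadicInterval.parent_plus] using congrArg DyadicInterval.parent h')
        by_cases he : J.IsEven <;> by_cases he' : P.IsEven <;>
          simp [he, he', hP', DyadicInterval.parent_plus,
            (DyadicInterval.plus_ne_minus _ _).symm, Ne.symm hP]
    · obtain ⟨P, rfl⟩ : ∃ P, L = DyadicInterval.minus P := ⟨_, h⟩
      by_cases hP : J = P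
      · subst hP
        by_cases he : J.IsEven <;> by_cases hJ : I = K <;>
          simp [he, hJ, eq_comm (a := K) (b := I), DyadicInterval.parent_minus, DyadicInterval.sign,
            (DyadicInterval.plus_ne_minus _ _).symm]
      · have hP' : J.minus ≠ P.minus := fun h' => hP (by
          simpa [DyadicInterval.parent_minus] using congrArg DyadicInterval.parent h')
        by_cases he : J.IsEven <;> by_cases he' : P.IsEven <;>
          simp [he, he', hP', DyadicInterval.parent_minus,
            DyadicInterval.plus_ne_minus, Ne.symm hP]
  refine HaarPoly.pair_adjoint_of_single _ _ key f g

/-- Multiplication by `b`, as the form `(f, g) ↦ (b f, g)` on test functions. -/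
def mulForm (b : ℝ × ℝ → ℝ) (f g : HaarPoly) : ℝ := ∫ p, b p * f.eval p * g.eval p

/-- The commutator `[T, B]` of an operator `T` with adjoint `T'` and an operator `B` that is given
by its form `B f g = (B f, g)`:  `([T, B] f, g) = (B f, T' g) - (B (T f), g)`. -/
def formCommutator (T T' : HaarPoly →ₗ[ℝ] HaarPoly) (B : HaarPoly → HaarPoly → ℝ)
    (f g : HaarPoly) : ℝ :=
  B f (T' g) - B (T f) g

/-- The form `(f, g) ↦ ([T₂, [T₁, b]] f, g)` of the repeated commutator. -/
def repeatedCommutator (b : ℝ × ℝ → ℝ) : HaarPoly → HaarPoly → ℝ :=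
  formCommutator shift₂ shiftAdj₂ (formCommutator shift₁ shiftAdj₁ (mulForm b))

/-- The norm of `[T₂, [T₁, b]]` as an operator on `L²(ℝ²)`, an element of `[0, ∞]`
(`∞` if the repeated commutator is unbounded). Test functions are dense in `L²(ℝ²)`. -/
def commutatorNorm (b : ℝ × ℝ → ℝ) : ℝ≥0∞ :=
  ⨆ (f : HaarPoly) (g : HaarPoly) (_ : eLpNorm f.eval 2 volume ≤ 1)
    (_ : eLpNorm g.eval 2 volume ≤ 1), ENNReal.ofReal |repeatedCommutator b f g|

/-- `b` skips scales: `(b, h_I ⊗ h_J) ≠ 0` only if `I` and `J` are both even. -/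
def SkipsScales (b : ℝ × ℝ → ℝ) : Prop :=
  ∀ R : DyadicRect, haarCoeff b R ≠ 0 → R.1.IsEven ∧ R.2.IsEven

/-- A dyadic open set is a finite union of dyadic rectangles. -/
def IsDyadicOpen (U : Set (ℝ × ℝ)) : Prop :=
  ∃ s : Finset DyadicRect, U = ⋃ R ∈ s, DyadicRect.toSet R

/-- `∑ (b, h_I ⊗ h_J)²` over all dyadic rectangles `I × J ⊆ U`. -/
def haarEnergy (b : ℝ × ℝ → ℝ) (U : Set (ℝ × ℝ)) : ℝ≥0∞ :=
  ∑' R : {R : DyadicRect // R.toSet ⊆ U}, ENNReal.ofReal (haarCoeff b R ^ 2)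

/-- The dyadic Chang–Fefferman norm: the square root of the supremum of
`|U|⁻¹ ∑_{I × J ⊆ U} (b, h_I ⊗ h_J)²` over all non-empty dyadic open sets `U`. -/
def changFeffermanNorm (b : ℝ × ℝ → ℝ) : ℝ≥0∞ :=
  (⨆ (U : Set (ℝ × ℝ)) (_ : IsDyadicOpen U) (_ : U.Nonempty),
    haarEnergy b U / volume U) ^ (1 / 2 : ℝ)

end

open MeasureTheory
open scoped ENNReal NNReal

noncomputable section

/-! ### Haar functions on the line -/

namespace DyadicInterval

/-! The commutator, tested against `T₁T₂h_R` for an even rectangle `R`, reads off `(b, h_R)`, and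
duality then bounds the sum of squares.

Let `T` be the one-variable shift. On even intervals `T*T = 2`, so the commutator form at the pair
`h_I ⊗ h_L`, `T₁T₂(h_K ⊗ h_J)` with `K`, `J` even is the integral of `b` against the tensor product
of `2 h_I h_K - Th_I Th_K` and `2 h_L h_J - Th_L Th_J` (`repeatedCommutator_single_eq_integral`). If
`I = K`, the first factor vanishes, because `(Th_K)² = 2 h_K²` pointwise. If `I ≠ K`, then `Th_I
Th_K` is a combination of Haar functions of odd intervals, and a function `b` that skips scales does
not see these. The second factor behaves alike. What survives is `4 (b h_S, h_R)`, and only for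
those `S` that share neither side with `R` (`SkipsScales.repeatedCommutator_single`).

If `f = 1` on `R`, discarding the terms of `f` that share a side with `R` does not change `f` on
`R`: the discarded coefficients are integrals of a constant against a Haar function. So the form at
`f`, `T₁T₂h_R` equals `4 (b, h_R)` (`SkipsScales.repeatedCommutator_eq_haarCoeff`).

One test function `f` with `f = 1` on `U` and norm at most `4|U|^(1/2)` serves all `R ⊆ U`. The
indicator of `U` is not a finite Haar sum; it is corrected by far away copies of its grid cells,
which supply the missing cancellation in each variable (`exists_haarPoly_eq_one`). With `g = ∑ (b,
h_R) h_R` and `A = ∑ (b, h_R)²`, Parseval gives `‖T₁T₂g‖ = 2A^(1/2)`, hence `4A ≤ ‖[T₂,[T₁,b]]‖ ·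
4|U|^(1/2) · 2A^(1/2)`, that is `A ≤ 4 ‖[T₂,[T₁,b]]‖² |U|`. -/

theorem length_pos (I : DyadicInterval) : 0 < I.length := by
  unfold length; positivity

theorem length_plus (I : DyadicInterval) : I.plus.length = I.length / 2 := by
  simp only [length, plus, neg_add, zpow_add₀ (two_ne_zero' ℝ)]
  norm_num; ring

theorem length_minus (I : DyadicInterval) : I.minus.length = I.length / 2 :=
  I.length_plus

/-- Turns nesting and disjointness of dyadic intervals into integer arithmetic: passing to an
ancestor is floor division by a power of two. -/
theorem mem_toSet_iff (I : DyadicInterval) (x : ℝ) :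
    x ∈ I.toSet ↔ ⌊x * 2 ^ I.scale⌋ = I.pos := by
  have h : (0 : ℝ) < 2 ^ I.scale := by positivity
  rw [Int.floor_eq_iff]
  simp only [toSet, length, zpow_neg, Set.mem_Ico, ← div_eq_mul_inv, div_le_iff₀ h, lt_div_iff₀ h]

theorem floor_mul_two_zpow_div (x : ℝ) (k : ℤ) (d : ℕ) :
    ⌊x * 2 ^ k⌋ = ⌊x * 2 ^ (k + d)⌋ / 2 ^ d := by
  have h := Int.floor_div_natCast (x * 2 ^ (k + d)) (2 ^ d)
  push_cast at h
  rw [← h, zpow_add₀ (two_ne_zero' ℝ), zpow_natCast, ← mul_assoc, mul_div_cancel_right₀]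
  positivity

theorem mem_toSet_iff_of_scale_le {I K : DyadicInterval} {d : ℕ} (h : K.scale = I.scale + d)
    {x : ℝ} (hx : x ∈ K.toSet) : x ∈ I.toSet ↔ K.pos / 2 ^ d = I.pos := by
  rw [mem_toSet_iff] at hx
  rw [mem_toSet_iff, floor_mul_two_zpow_div x _ d, ← h, hx]

theorem mem_toSet_congr {I K : DyadicInterval} (h : I.scale ≤ K.scale) {x y : ℝ}
    (hx : x ∈ K.toSet) (hy : y ∈ K.toSet) : x ∈ I.toSet ↔ y ∈ I.toSet := by
  obtain ⟨d, hd⟩ := Int.le.dest h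
  rw [mem_toSet_iff_of_scale_le hd.symm hx, mem_toSet_iff_of_scale_le hd.symm hy]

theorem eq_of_mem_of_mem {I K : DyadicInterval} (h : I.scale = K.scale) {x : ℝ}
    (hI : x ∈ I.toSet) (hK : x ∈ K.toSet) : I = K := by
  rw [mem_toSet_iff] at hI hK
  ext
  · exact h
  · rw [← hI, ← hK, h]

theorem mem_toSet_iff_minus_or_plus (I : DyadicInterval) (x : ℝ) :
    x ∈ I.toSet ↔ x ∈ I.minus.toSet ∨ x ∈ I.plus.toSet := by
  rw [mem_toSet_iff, mem_toSet_iff, mem_toSet_iff, floor_mul_two_zpow_div x _ 1]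
  simp only [minus, plus]
  push_cast
  omega

theorem not_mem_minus_of_mem_plus {I : DyadicInterval} {x : ℝ} (h : x ∈ I.plus.toSet) :
    x ∉ I.minus.toSet :=
  fun h' => plus_ne_minus I I (eq_of_mem_of_mem rfl h h')

theorem measurableSet_toSet (I : DyadicInterval) : MeasurableSet I.toSet :=
  measurableSet_Ico

theorem volume_toSet (I : DyadicInterval) : volume I.toSet = ENNReal.ofReal I.length := by
  rw [toSet, Real.volume_Ico]
  ring_nf

theorem nonempty_toSet (I : DyadicInterval) : I.toSet.Nonempty :=
  Set.nonempty_Ico.2 (by nlinarith [I.length_pos])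

theorem haar_of_mem_plus {I : DyadicInterval} {x : ℝ} (h : x ∈ I.plus.toSet) :
    I.haar x = (Real.sqrt I.length)⁻¹ := by
  simp [haar, h, not_mem_minus_of_mem_plus h]

theorem haar_of_mem_minus {I : DyadicInterval} {x : ℝ} (h : x ∈ I.minus.toSet) :
    I.haar x = -(Real.sqrt I.length)⁻¹ := by
  have h' : x ∉ I.plus.toSet := fun h' => not_mem_minus_of_mem_plus h' h
  simp [haar, h, h']

theorem haar_of_not_mem {I : DyadicInterval} {x : ℝ} (h : x ∉ I.toSet) : I.haar x = 0 := by
  rw [mem_toSet_iff_minus_or_plus, not_or] at h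
  simp [haar, h]

theorem haar_sq (I : DyadicInterval) (x : ℝ) :
    I.haar x * I.haar x = I.toSet.indicator (fun _ => I.length⁻¹) x := by
  have key : (Real.sqrt I.length)⁻¹ * (Real.sqrt I.length)⁻¹ = I.length⁻¹ := by
    rw [← mul_inv, Real.mul_self_sqrt I.length_pos.le]
  by_cases h : x ∈ I.toSet
  · rw [Set.indicator_of_mem h]
    rcases (mem_toSet_iff_minus_or_plus I x).1 h with h | h
    · rw [haar_of_mem_minus h, neg_mul_neg, key]
    · rw [haar_of_mem_plus h, key]
  · rw [Set.indicator_of_notMem h, haar_of_not_mem h, zero_mul]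

theorem measurable_haar (I : DyadicInterval) : Measurable I.haar := by
  unfold haar
  exact measurable_const.mul ((measurable_const.indicator I.plus.measurableSet_toSet).sub
    (measurable_const.indicator I.minus.measurableSet_toSet))

theorem abs_haar_le (I : DyadicInterval) (x : ℝ) : |I.haar x| ≤ (Real.sqrt I.length)⁻¹ := by
  have h0 : 0 ≤ (Real.sqrt I.length)⁻¹ := by positivity
  by_cases h : x ∈ I.toSet
  · rcases (mem_toSet_iff_minus_or_plus I x).1 h with h | h
    · rw [haar_of_mem_minus h, abs_neg, abs_of_nonneg h0]
    · rw [haar_of_mem_plus h, abs_of_nonneg h0]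
  · rw [haar_of_not_mem h, abs_zero]; exact h0

theorem integrable_indicator (I : DyadicInterval) (c : ℝ) :
    Integrable (I.toSet.indicator fun _ => c) := by
  rw [integrable_indicator_iff I.measurableSet_toSet]
  exact integrableOn_const (by rw [volume_toSet]; exact ENNReal.ofReal_ne_top)

theorem integral_indicator (I : DyadicInterval) (c : ℝ) :
    ∫ x, I.toSet.indicator (fun _ => c) x = I.length * c := by
  rw [integral_indicator_const _ I.measurableSet_toSet, measureReal_def, volume_toSet,
    ENNReal.toReal_ofReal I.length_pos.le, smul_eq_mul]

theorem integrable_haar (I : DyadicInterval) : Integrable I.haar :=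
  ((I.plus.integrable_indicator 1).sub (I.minus.integrable_indicator 1)).const_mul _

theorem integral_haar (I : DyadicInterval) : ∫ x, I.haar x = 0 := by
  unfold haar
  rw [integral_const_mul, integral_sub (I.plus.integrable_indicator 1)
    (I.minus.integrable_indicator 1), integral_indicator, integral_indicator, length_plus,
    length_minus]
  simp

/-- A coarser Haar function is constant on a finer dyadic interval. -/
theorem haar_congr {I K : DyadicInterval} (h : I.scale < K.scale) {x y : ℝ}
    (hx : x ∈ K.toSet) (hy : y ∈ K.toSet) : I.haar x = I.haar y := by
  have hp := mem_toSet_congr (I := I.plus) (Int.add_one_le_iff.2 h) hx hy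
  have hm := mem_toSet_congr (I := I.minus) (Int.add_one_le_iff.2 h) hx hy
  classical
  simp only [haar, Set.indicator_apply, hp, hm]

theorem haar_mul_haar_of_scale_eq {I K : DyadicInterval} (h : I.scale = K.scale) (hne : I ≠ K)
    (x : ℝ) : I.haar x * K.haar x = 0 := by
  by_cases hI : x ∈ I.toSet
  · by_cases hK : x ∈ K.toSet
    · exact absurd (eq_of_mem_of_mem h hI hK) hne
    · rw [haar_of_not_mem hK, mul_zero]
  · rw [haar_of_not_mem hI, zero_mul]

/-! ### Haar spans and products of Haar functions -/

/-- Finite linear combinations of Haar functions on the line. -/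
def haarSpan : Submodule ℝ (ℝ → ℝ) := Submodule.span ℝ (Set.range haar)

/-- Finite linear combinations of Haar functions of odd intervals. -/
def oddHaarSpan : Submodule ℝ (ℝ → ℝ) := Submodule.span ℝ (haar '' {I | ¬ I.IsEven})

theorem haar_mem_haarSpan (I : DyadicInterval) : I.haar ∈ haarSpan :=
  Submodule.subset_span ⟨I, rfl⟩

theorem oddHaarSpan_le : oddHaarSpan ≤ haarSpan :=
  Submodule.span_mono (Set.image_subset_range _ _)

theorem integrable_and_integral_of_mem_haarSpan {u : ℝ → ℝ} (hu : u ∈ haarSpan) :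
    Integrable u ∧ ∫ x, u x = 0 := by
  induction hu using Submodule.span_induction with
  | mem u hu =>
    obtain ⟨I, rfl⟩ := hu
    exact ⟨I.integrable_haar, I.integral_haar⟩
  | zero => exact ⟨integrable_zero _ _ _, by simp⟩
  | add u v _ _ hu hv =>
    refine ⟨hu.1.add hv.1, ?_⟩
    simp only [Pi.add_apply]
    rw [integral_add hu.1 hv.1, hu.2, hv.2, add_zero]
  | smul c u _ hu =>
    refine ⟨hu.1.smul c, ?_⟩
    simp only [Pi.smul_apply]
    rw [integral_smul, hu.2, smul_zero]

theorem mul_haar_of_scale_lt {u : ℝ → ℝ} {K : DyadicInterval}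
    (hu : ∀ x ∈ K.toSet, ∀ y ∈ K.toSet, u x = u y) : ∃ c : ℝ, u * K.haar = c • K.haar := by
  obtain ⟨y, hy⟩ := K.nonempty_toSet
  refine ⟨u y, funext fun x => ?_⟩
  simp only [Pi.mul_apply, Pi.smul_apply, smul_eq_mul]
  by_cases hx : x ∈ K.toSet
  · rw [hu x hx y hy]
  · rw [haar_of_not_mem hx, mul_zero, mul_zero]

/-- At different scales the coarser function is constant on the support of the finer one, so the
product is a multiple of the finer; at equal scales the supports are disjoint. -/
theorem haar_mul_haar_mem_haarSpan {I K : DyadicInterval} (hne : I ≠ K) :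
    I.haar * K.haar ∈ haarSpan := by
  rcases lt_trichotomy I.scale K.scale with h | h | h
  · obtain ⟨c, hc⟩ := mul_haar_of_scale_lt (u := I.haar) (K := K)
      fun x hx y hy => haar_congr h hx hy
    rw [hc]
    exact haarSpan.smul_mem _ K.haar_mem_haarSpan
  · rw [show I.haar * K.haar = 0 from funext fun x => haar_mul_haar_of_scale_eq h hne x]
    exact haarSpan.zero_mem
  · obtain ⟨c, hc⟩ := mul_haar_of_scale_lt (u := K.haar) (K := I)
      fun x hx y hy => haar_congr h hx hy
    rw [mul_comm, hc]
    exact haarSpan.smul_mem _ I.haar_mem_haarSpan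

theorem integral_haar_mul_haar_of_ne {I K : DyadicInterval} (hne : I ≠ K) :
    ∫ x, I.haar x * K.haar x = 0 :=
  (integrable_and_integral_of_mem_haarSpan (haar_mul_haar_mem_haarSpan hne)).2

theorem integral_haar_mul_self (I : DyadicInterval) : ∫ x, I.haar x * I.haar x = 1 := by
  simp_rw [haar_sq]
  rw [integral_indicator, mul_inv_cancel₀ I.length_pos.ne']

/-! ### The one-variable shift and its products -/

open Classical in
/-- The image of `h_I` under the one-variable dyadic shift. -/
def shiftHaar (I : DyadicInterval) (x : ℝ) : ℝ :=
  if I.IsEven then I.plus.haar x - I.minus.haar x else 0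

/-- The functions of the two halves have disjoint supports, so the cross term drops out; each square
is `2/|I|` on its half, twice the value of `h_I²`. -/
theorem shiftHaar_mul_self {I : DyadicInterval} (hI : I.IsEven) (x : ℝ) :
    I.shiftHaar x * I.shiftHaar x = 2 * (I.haar x * I.haar x) := by
  have h0 := haar_mul_haar_of_scale_eq (I := I.plus) (K := I.minus) rfl (plus_ne_minus I I) x
  have hp := I.plus.haar_sq x
  have hm := I.minus.haar_sq x
  have hI' := I.haar_sq x
  rw [length_plus] at hp
  rw [length_minus] at hm
  have hsum : I.shiftHaar x * I.shiftHaar x =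
      I.plus.haar x * I.plus.haar x + I.minus.haar x * I.minus.haar x := by
    simp only [shiftHaar, hI, if_true]
    linear_combination (-2) * h0
  rw [hsum, hp, hm, hI']
  by_cases h : x ∈ I.plus.toSet
  · have h' := not_mem_minus_of_mem_plus h
    have h'' := (I.mem_toSet_iff_minus_or_plus x).2 (Or.inr h)
    simp [h, h', h'', div_eq_mul_inv, mul_comm]
  · by_cases h' : x ∈ I.minus.toSet
    · have h'' := (I.mem_toSet_iff_minus_or_plus x).2 (Or.inl h')
      simp [h, h', h'', div_eq_mul_inv, mul_comm]
    · have h'' : x ∉ I.toSet := by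
        rw [I.mem_toSet_iff_minus_or_plus x]; tauto
      simp [h, h', h'']

theorem not_isEven_of_scale_eq_add_one {I O : DyadicInterval} (hI : I.IsEven)
    (h : O.scale = I.scale + 1) : ¬ O.IsEven := by
  unfold IsEven at *
  rw [h, Int.even_add_one]
  simpa using hI

/-- The halves of `K` are finer than those of `I`, so `Th_I` is constant on each half of `K` and the
product is a combination of the Haar functions of these halves. They are odd because `K` is even. -/
theorem shiftHaar_mul_shiftHaar_of_lt {I K : DyadicInterval} (h : I.scale < K.scale) :
    I.shiftHaar * K.shiftHaar ∈ oddHaarSpan := by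
  by_cases hK : K.IsEven
  swap
  · convert oddHaarSpan.zero_mem
    ext x; simp [shiftHaar, hK]
  by_cases hI : I.IsEven
  swap
  · convert oddHaarSpan.zero_mem
    ext x; simp [shiftHaar, hI]
  have hlt : I.scale + 1 < K.scale := by
    obtain ⟨a, ha⟩ := hK
    obtain ⟨c, hc⟩ := hI
    omega
  have hconst (O : DyadicInterval) (hO : O.scale = K.scale + 1) :
      I.shiftHaar * O.haar ∈ oddHaarSpan := by
    obtain ⟨c, hc⟩ := mul_haar_of_scale_lt (u := I.shiftHaar) (K := O) (fun x hx y hy => by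
      have hp := haar_congr (I := I.plus) (K := O) (by simp only [plus]; omega) hx hy
      have hm := haar_congr (I := I.minus) (K := O) (by simp only [minus]; omega) hx hy
      simp only [shiftHaar, hI, if_true, hp, hm])
    rw [hc]
    exact oddHaarSpan.smul_mem _
      (Submodule.subset_span ⟨O, not_isEven_of_scale_eq_add_one hK hO, rfl⟩)
  have : I.shiftHaar * K.shiftHaar = I.shiftHaar * K.plus.haar - I.shiftHaar * K.minus.haar := by
    ext x; simp only [shiftHaar, hK, if_true, Pi.mul_apply, Pi.sub_apply]; ring
  rw [this]
  exact oddHaarSpan.sub_mem (hconst _ rfl) (hconst _ rfl)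

theorem shiftHaar_of_not_mem {I : DyadicInterval} {x : ℝ} (h : x ∉ I.toSet) :
    I.shiftHaar x = 0 := by
  rw [mem_toSet_iff_minus_or_plus, not_or] at h
  simp [shiftHaar, haar_of_not_mem h.1, haar_of_not_mem h.2]

theorem shiftHaar_mul_shiftHaar_mem_oddHaarSpan {I K : DyadicInterval} (hne : I ≠ K) :
    I.shiftHaar * K.shiftHaar ∈ oddHaarSpan := by
  rcases lt_trichotomy I.scale K.scale with h | h | h
  · exact shiftHaar_mul_shiftHaar_of_lt h
  · convert oddHaarSpan.zero_mem
    ext x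
    by_cases hI : x ∈ I.toSet
    · have hK : x ∉ K.toSet := fun hK => hne (eq_of_mem_of_mem h hI hK)
      simp [shiftHaar_of_not_mem hK]
    · simp [shiftHaar_of_not_mem hI]
  · rw [mul_comm]
    exact shiftHaar_mul_shiftHaar_of_lt h

/-! ### Indicators modulo Haar functions -/

theorem indicator_plus_sub_half (P : DyadicInterval) :
    P.plus.toSet.indicator (1 : ℝ → ℝ) - (2⁻¹ : ℝ) • P.toSet.indicator 1 =
      (2⁻¹ * Real.sqrt P.length) • P.haar := by
  have h2 : Real.sqrt P.length ≠ 0 := (Real.sqrt_pos.2 P.length_pos).ne'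
  ext x
  simp only [Pi.sub_apply, Pi.smul_apply, smul_eq_mul]
  by_cases h : x ∈ P.plus.toSet
  · rw [haar_of_mem_plus h, Set.indicator_of_mem h,
      Set.indicator_of_mem ((P.mem_toSet_iff_minus_or_plus x).2 (Or.inr h))]
    field_simp; norm_num
  · rw [Set.indicator_of_notMem h]
    by_cases h' : x ∈ P.minus.toSet
    · rw [haar_of_mem_minus h',
        Set.indicator_of_mem ((P.mem_toSet_iff_minus_or_plus x).2 (Or.inl h'))]
      field_simp; norm_num
    · have h'' : x ∉ P.toSet := by rw [P.mem_toSet_iff_minus_or_plus x]; tauto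
      rw [haar_of_not_mem h'', Set.indicator_of_notMem h'']
      ring

theorem indicator_minus_sub_half (P : DyadicInterval) :
    P.minus.toSet.indicator (1 : ℝ → ℝ) - (2⁻¹ : ℝ) • P.toSet.indicator 1 =
      -(P.plus.toSet.indicator (1 : ℝ → ℝ) - (2⁻¹ : ℝ) • P.toSet.indicator 1) := by
  have : P.toSet.indicator (1 : ℝ → ℝ) = P.minus.toSet.indicator 1 + P.plus.toSet.indicator 1 := by
    refine Eq.trans ?_ (Set.indicator_union_of_disjoint
      (Set.disjoint_left.2 fun _ h h' => not_mem_minus_of_mem_plus h' h) 1)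
    congr 1
    ext x
    exact P.mem_toSet_iff_minus_or_plus x
  rw [this]
  module

/-- `1_I - 1_{Î} / 2` is a multiple of `h_{Î}`. -/
theorem indicator_sub_half_parent_mem_haarSpan (I : DyadicInterval) :
    I.toSet.indicator 1 - (2⁻¹ : ℝ) • I.parent.toSet.indicator 1 ∈ haarSpan := by
  have hp : I.parent.plus.toSet.indicator 1 - (2⁻¹ : ℝ) • I.parent.toSet.indicator 1 ∈
      haarSpan := by
    rw [indicator_plus_sub_half]
    exact haarSpan.smul_mem _ I.parent.haar_mem_haarSpan
  rcases I.eq_plus_or_eq_minus with h | h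
  · rwa [← h] at hp
  · have hm := haarSpan.neg_mem hp
    rwa [← indicator_minus_sub_half, ← h] at hm

/-- Indicators of two intervals of the same generation with a common ancestor differ by a
combination of Haar functions. -/
theorem indicator_sub_indicator_mem_haarSpan (k : ℕ) (m i j : ℤ) (h : i / 2 ^ k = j / 2 ^ k) :
    (toSet ⟨m, i⟩).indicator 1 - (toSet ⟨m, j⟩).indicator 1 ∈ haarSpan := by
  induction k generalizing m i j with
  | zero =>
    simp only [pow_zero, Int.ediv_one] at h
    rw [h, sub_self]
    exact haarSpan.zero_mem
  | succ k ih =>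
    have h' : i / 2 / 2 ^ k = j / 2 / 2 ^ k := by
      rw [Int.ediv_ediv_of_nonneg (by norm_num), Int.ediv_ediv_of_nonneg (by norm_num),
        ← pow_succ', h]
    have h1 := indicator_sub_half_parent_mem_haarSpan ⟨m, i⟩
    have h2 := indicator_sub_half_parent_mem_haarSpan ⟨m, j⟩
    have h3 := haarSpan.smul_mem (2⁻¹ : ℝ) (ih (m - 1) (i / 2) (j / 2) h')
    simp only [parent] at h1 h2
    -- Each indicator is half that of its parent modulo `haarSpan`, so the difference reduces to
    -- half the difference of the parents.
    convert haarSpan.add_mem (haarSpan.sub_mem h1 h2) h3 using 1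
    rw [smul_sub]
    abel

end DyadicInterval

open DyadicInterval

/-! ### Functions that can be paired with `b` -/

/-- Bounded measurable functions on the plane that vanish outside a bounded set. -/
def boundedCompactFun : Submodule ℝ (ℝ × ℝ → ℝ) where
  carrier := {F | Measurable F ∧ (∃ C, ∀ p, ‖F p‖ ≤ C) ∧
    ∃ r, ∀ p ∉ Metric.closedBall (0 : ℝ × ℝ) r, F p = 0}
  add_mem' := by
    rintro F G ⟨hF, ⟨C, hC⟩, r, hr⟩ ⟨hG, ⟨C', hC'⟩, r', hr'⟩
    refine ⟨hF.add hG, ⟨C + C', fun p => (norm_add_le _ _).trans (add_le_add (hC p) (hC' p))⟩,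
      max r r', fun p hp => ?_⟩
    simp only [Pi.add_apply]
    rw [hr p fun h => hp (Metric.closedBall_subset_closedBall (le_max_left _ _) h),
      hr' p fun h => hp (Metric.closedBall_subset_closedBall (le_max_right _ _) h), add_zero]
  zero_mem' := ⟨measurable_const, ⟨0, by simp⟩, 0, by simp⟩
  smul_mem' := by
    rintro c F ⟨hF, ⟨C, hC⟩, r, hr⟩
    refine ⟨hF.const_smul c, ⟨‖c‖ * C, fun p => ?_⟩, r, fun p hp => ?_⟩
    · rw [Pi.smul_apply, norm_smul]
      exact mul_le_mul_of_nonneg_left (hC p) (norm_nonneg c)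
    · rw [Pi.smul_apply, hr p hp, smul_zero]

theorem mul_mem_boundedCompactFun {F G : ℝ × ℝ → ℝ} (hF : F ∈ boundedCompactFun)
    (hG : G ∈ boundedCompactFun) : F * G ∈ boundedCompactFun := by
  obtain ⟨hF, ⟨C, hC⟩, r, hr⟩ := hF
  obtain ⟨hG, ⟨C', hC'⟩, -⟩ := hG
  refine ⟨hF.mul hG, ⟨C * C', fun p => ?_⟩, r, fun p hp => ?_⟩
  · rw [Pi.mul_apply, norm_mul]
    exact mul_le_mul (hC p) (hC' p) (norm_nonneg _) ((norm_nonneg _).trans (hC p))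
  · rw [Pi.mul_apply, hr p hp, zero_mul]

theorem integrable_mul_of_mem_boundedCompactFun {b F : ℝ × ℝ → ℝ}
    (hb : LocallyIntegrable b volume) (hF : F ∈ boundedCompactFun) :
    Integrable fun p => b p * F p := by
  obtain ⟨hF, ⟨C, hC⟩, r, hr⟩ := hF
  have h1 : IntegrableOn b (Metric.closedBall 0 r) volume :=
    hb.integrableOn_isCompact (isCompact_closedBall _ _)
  have h2 : IntegrableOn (fun p => b p * F p) (Metric.closedBall 0 r) volume :=
    h1.mul_bdd (c := C) hF.aestronglyMeasurable (Filter.Eventually.of_forall hC)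
  exact h2.integrable_of_forall_notMem_eq_zero fun p hp => by rw [hr p hp, mul_zero]

/-- The tensor product of two functions on the line. -/
def tensor (u v : ℝ → ℝ) (p : ℝ × ℝ) : ℝ := u p.1 * v p.2

theorem abs_le_of_mem_toSet {I : DyadicInterval} {x : ℝ} (hx : x ∈ I.toSet) :
    |x| ≤ |(I.pos : ℝ) * I.length| + |((I.pos : ℝ) + 1) * I.length| := by
  have h1 := neg_abs_le ((I.pos : ℝ) * I.length)
  have h2 := le_abs_self (((I.pos : ℝ) + 1) * I.length)
  have h3 := abs_nonneg ((I.pos : ℝ) * I.length)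
  have h4 := abs_nonneg (((I.pos : ℝ) + 1) * I.length)
  rw [abs_le]
  constructor <;> linarith [hx.1, hx.2]

theorem haar_mem_boundedCompactFun (R : DyadicRect) : R.haar ∈ boundedCompactFun := by
  refine ⟨(R.1.measurable_haar.comp measurable_fst).mul (R.2.measurable_haar.comp measurable_snd),
    ⟨(Real.sqrt R.1.length)⁻¹ * (Real.sqrt R.2.length)⁻¹, fun p => ?_⟩, ?_⟩
  · rw [DyadicRect.haar, norm_mul]
    exact mul_le_mul (R.1.abs_haar_le _) (R.2.abs_haar_le _) (norm_nonneg _) (by positivity)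
  · refine ⟨max (|(R.1.pos : ℝ) * R.1.length| + |((R.1.pos : ℝ) + 1) * R.1.length|)
      (|(R.2.pos : ℝ) * R.2.length| + |((R.2.pos : ℝ) + 1) * R.2.length|), fun p hp => ?_⟩
    by_contra h
    obtain ⟨h1, h2⟩ := mul_ne_zero_iff.1 h
    have h1 : p.1 ∈ R.1.toSet := by_contra fun h' => h1 (haar_of_not_mem h')
    have h2 : p.2 ∈ R.2.toSet := by_contra fun h' => h2 (haar_of_not_mem h')
    apply hp
    rw [mem_closedBall_zero_iff, Prod.norm_def]
    exact max_le_max (abs_le_of_mem_toSet h1) (abs_le_of_mem_toSet h2)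

/-- Bilinearity of the tensor product. It serves with `M` the annihilator of `b` and with `M` the
space of test functions. -/
theorem tensor_mem_of_mem_span {A B : Set (ℝ → ℝ)} {M : Submodule ℝ (ℝ × ℝ → ℝ)}
    (h : ∀ u ∈ A, ∀ v ∈ B, tensor u v ∈ M) {u v : ℝ → ℝ} (hu : u ∈ Submodule.span ℝ A)
    (hv : v ∈ Submodule.span ℝ B) : tensor u v ∈ M := by
  induction hu using Submodule.span_induction with
  | mem u hu =>
    induction hv using Submodule.span_induction with
    | mem v hv => exact h u hu v hv
    | zero => convert M.zero_mem; ext p; simp [tensor]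
    | add v w _ _ hv hw => convert M.add_mem hv hw; ext p; simp [tensor, mul_add]
    | smul c v _ hv => convert M.smul_mem c hv; ext p; simp [tensor, mul_left_comm]
  | zero => convert M.zero_mem; ext p; simp [tensor]
  | add v w _ _ hv hw => convert M.add_mem hv hw; ext p; simp [tensor, add_mul]
  | smul c v _ hv => convert M.smul_mem c hv; ext p; simp [tensor, mul_assoc]

/-- Bounded compactly supported functions whose product with `b` has integral zero. -/
def annihilator {b : ℝ × ℝ → ℝ} (hb : LocallyIntegrable b volume) :
    Submodule ℝ (ℝ × ℝ → ℝ) where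
  carrier := {F | F ∈ boundedCompactFun ∧ ∫ p, b p * F p = 0}
  add_mem' := by
    rintro F G ⟨hF, hF'⟩ ⟨hG, hG'⟩
    refine ⟨boundedCompactFun.add_mem hF hG, ?_⟩
    simp only [Pi.add_apply, mul_add]
    rw [integral_add (integrable_mul_of_mem_boundedCompactFun hb hF)
      (integrable_mul_of_mem_boundedCompactFun hb hG), hF', hG', add_zero]
  zero_mem' := ⟨boundedCompactFun.zero_mem, by simp⟩
  smul_mem' := by
    rintro c F ⟨hF, hF'⟩
    refine ⟨boundedCompactFun.smul_mem c hF, ?_⟩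
    simp only [Pi.smul_apply, smul_eq_mul, mul_left_comm _ c]
    rw [integral_const_mul, hF', mul_zero]

theorem SkipsScales.haar_mem_annihilator {b : ℝ × ℝ → ℝ} (hb : LocallyIntegrable b volume)
    (hs : SkipsScales b) {R : DyadicRect} (hR : ¬ (R.1.IsEven ∧ R.2.IsEven)) :
    R.haar ∈ annihilator hb :=
  ⟨haar_mem_boundedCompactFun R, by_contra fun h => hR (hs R h)⟩

theorem SkipsScales.tensor_odd_left {b : ℝ × ℝ → ℝ} (hb : LocallyIntegrable b volume)
    (hs : SkipsScales b) {u v : ℝ → ℝ} (hu : u ∈ oddHaarSpan) (hv : v ∈ haarSpan) :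
    tensor u v ∈ annihilator hb := by
  refine tensor_mem_of_mem_span ?_ hu hv
  rintro _ ⟨I, hI, rfl⟩ _ ⟨J, rfl⟩
  exact hs.haar_mem_annihilator hb (R := (I, J)) fun h => hI h.1

theorem SkipsScales.tensor_odd_right {b : ℝ × ℝ → ℝ} (hb : LocallyIntegrable b volume)
    (hs : SkipsScales b) {u v : ℝ → ℝ} (hu : u ∈ haarSpan) (hv : v ∈ oddHaarSpan) :
    tensor u v ∈ annihilator hb := by
  refine tensor_mem_of_mem_span ?_ hu hv
  rintro _ ⟨I, rfl⟩ _ ⟨J, hJ, rfl⟩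
  exact hs.haar_mem_annihilator hb (R := (I, J)) fun h => hJ h.2

/-! ### Test functions as functions on the plane -/

namespace HaarPoly

/-- `HaarPoly.eval` as a linear map. -/
def evalₗ : HaarPoly →ₗ[ℝ] (ℝ × ℝ → ℝ) :=
  Finsupp.linearCombination ℝ DyadicRect.haar

theorem evalₗ_apply (f : HaarPoly) : evalₗ f = f.eval := by
  ext p
  simp [evalₗ, eval, Finsupp.linearCombination_apply, Finsupp.sum, Finset.sum_apply]

theorem eval_add (f g : HaarPoly) : (f + g).eval = f.eval + g.eval := by
  simp only [← evalₗ_apply, map_add]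

theorem eval_sub (f g : HaarPoly) : (f - g).eval = f.eval - g.eval := by
  simp only [← evalₗ_apply, map_sub]

theorem eval_smul (c : ℝ) (f : HaarPoly) : (c • f).eval = c • f.eval := by
  simp only [← evalₗ_apply, map_smul]

theorem eval_zero : (0 : HaarPoly).eval = 0 := by
  simp only [← evalₗ_apply, map_zero]

theorem eval_single (R : DyadicRect) (c : ℝ) : eval (Finsupp.single R c) = c • R.haar := by
  rw [← evalₗ_apply, evalₗ, Finsupp.linearCombination_single]

theorem eval_mem_boundedCompactFun (f : HaarPoly) : f.eval ∈ boundedCompactFun := by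
  induction f using Finsupp.induction_linear with
  | zero => rw [eval_zero]; exact boundedCompactFun.zero_mem
  | add f g hf hg => rw [eval_add]; exact boundedCompactFun.add_mem hf hg
  | single R c =>
    rw [eval_single]; exact boundedCompactFun.smul_mem _ (haar_mem_boundedCompactFun R)

theorem exists_eval_eq_tensor {u v : ℝ → ℝ} (hu : u ∈ haarSpan) (hv : v ∈ haarSpan) :
    tensor u v ∈ LinearMap.range evalₗ := by
  refine tensor_mem_of_mem_span ?_ hu hv
  rintro _ ⟨I, rfl⟩ _ ⟨J, rfl⟩
  exact ⟨Finsupp.single (I, J) 1, by rw [evalₗ_apply, eval_single, one_smul]; rfl⟩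

/-! ### Parseval -/

theorem integral_haar_mul_haar (R S : DyadicRect) :
    ∫ p, R.haar p * S.haar p = Finsupp.single R (1 : ℝ) S := by
  classical
  have h : ∀ p : ℝ × ℝ, R.haar p * S.haar p =
      (R.1.haar p.1 * S.1.haar p.1) * (R.2.haar p.2 * S.2.haar p.2) := fun p => by
    simp only [DyadicRect.haar]; ring
  simp_rw [h]
  rw [Measure.volume_eq_prod, integral_prod_mul (fun x => R.1.haar x * S.1.haar x)
    (fun y => R.2.haar y * S.2.haar y), Finsupp.single_apply]
  by_cases h1 : R.1 = S.1
  · by_cases h2 : R.2 = S.2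
    · rw [if_pos (Prod.ext h1 h2), h1, h2, integral_haar_mul_self, integral_haar_mul_self, one_mul]
    · rw [if_neg fun h => h2 (congrArg Prod.snd h), integral_haar_mul_haar_of_ne h2, mul_zero]
  · rw [if_neg fun h => h1 (congrArg Prod.fst h), integral_haar_mul_haar_of_ne h1, zero_mul]

theorem integrable_eval_mul_eval (f g : HaarPoly) : Integrable fun p => f.eval p * g.eval p := by
  simpa using integrable_mul_of_mem_boundedCompactFun (b := fun _ => 1)
    (locallyIntegrable_const 1)
    (mul_mem_boundedCompactFun f.eval_mem_boundedCompactFun g.eval_mem_boundedCompactFun)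

theorem integral_eval_mul_eval (f g : HaarPoly) : ∫ p, f.eval p * g.eval p = f.pair g := by
  induction f using Finsupp.induction_linear with
  | zero => simp [eval_zero, pair]
  | add u v hu hv =>
    rw [pair_eq_apply, map_add, ← pair_eq_apply, ← pair_eq_apply, ← hu, ← hv,
      ← integral_add (integrable_eval_mul_eval u g) (integrable_eval_mul_eval v g)]
    simp only [eval_add, Pi.add_apply, add_mul]
  | single R c =>
    induction g using Finsupp.induction_linear with
    | zero => simp [eval_zero, pair]
    | add u v hu hv =>
      rw [pair_comm, pair_eq_apply, map_add, ← pair_eq_apply, ← pair_eq_apply, pair_comm u,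
        pair_comm v, ← hu, ← hv, ← integral_add (integrable_eval_mul_eval _ u)
        (integrable_eval_mul_eval _ v)]
      simp only [eval_add, Pi.add_apply, mul_add]
    | single S d =>
      simp only [eval_single, Pi.smul_apply, smul_eq_mul]
      have h (p : ℝ × ℝ) : c * R.haar p * (d * S.haar p) = c * d * (R.haar p * S.haar p) := by
        ring
      simp_rw [h]
      rw [integral_const_mul, integral_haar_mul_haar]
      classical
      simp only [pair, Finsupp.single_apply, zero_mul, Finsupp.sum_single_index]
      by_cases h : R = S
      · simp [h]
      · simp [h, Ne.symm h]

theorem eLpNorm_eval (f : HaarPoly) :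
    eLpNorm f.eval 2 volume = ENNReal.ofReal (Real.sqrt (f.pair f)) := by
  have hm : MemLp f.eval 2 volume := by
    rw [memLp_two_iff_integrable_sq f.eval_mem_boundedCompactFun.1.aestronglyMeasurable]
    simpa only [sq] using integrable_eval_mul_eval f f
  rw [hm.eLpNorm_eq_integral_rpow_norm two_ne_zero ENNReal.ofNat_ne_top, Real.sqrt_eq_rpow,
    ← integral_eval_mul_eval]
  norm_num [sq]

end HaarPoly

/-! ### The form of the repeated commutator -/

theorem integrable_mulForm {b : ℝ × ℝ → ℝ} (hb : LocallyIntegrable b volume) (f g : HaarPoly) :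
    Integrable fun p => b p * f.eval p * g.eval p := by
  simpa only [Pi.mul_apply, mul_assoc] using integrable_mul_of_mem_boundedCompactFun hb
    (mul_mem_boundedCompactFun f.eval_mem_boundedCompactFun g.eval_mem_boundedCompactFun)

theorem mulForm_comm (b : ℝ × ℝ → ℝ) (f g : HaarPoly) : mulForm b f g = mulForm b g f := by
  unfold mulForm
  congr 1
  ext p
  ring

theorem mulForm_add_left {b : ℝ × ℝ → ℝ} (hb : LocallyIntegrable b volume) (f f' g : HaarPoly) :
    mulForm b (f + f') g = mulForm b f g + mulForm b f' g := by
  unfold mulForm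
  rw [← integral_add (integrable_mulForm hb f g) (integrable_mulForm hb f' g)]
  simp only [HaarPoly.eval_add, Pi.add_apply, mul_add, add_mul]

theorem mulForm_add_right {b : ℝ × ℝ → ℝ} (hb : LocallyIntegrable b volume) (f g g' : HaarPoly) :
    mulForm b f (g + g') = mulForm b f g + mulForm b f g' := by
  rw [mulForm_comm, mulForm_add_left hb, mulForm_comm b g, mulForm_comm b g']

theorem mulForm_smul_left (b : ℝ × ℝ → ℝ) (c : ℝ) (f g : HaarPoly) :
    mulForm b (c • f) g = c * mulForm b f g := by
  unfold mulForm
  rw [← integral_const_mul]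
  congr 1
  ext p
  simp only [HaarPoly.eval_smul, Pi.smul_apply, smul_eq_mul]
  ring

theorem mulForm_smul_right (b : ℝ × ℝ → ℝ) (c : ℝ) (f g : HaarPoly) :
    mulForm b f (c • g) = c * mulForm b f g := by
  rw [mulForm_comm, mulForm_smul_left, mulForm_comm]

theorem repeatedCommutator_eq (b : ℝ × ℝ → ℝ) (f g : HaarPoly) :
    repeatedCommutator b f g =
      mulForm b f (shiftAdj₁ (shiftAdj₂ g)) - mulForm b (shift₁ f) (shiftAdj₂ g) -
        (mulForm b (shift₂ f) (shiftAdj₁ g) - mulForm b (shift₁ (shift₂ f)) g) :=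
  rfl

theorem repeatedCommutator_add_left {b : ℝ × ℝ → ℝ} (hb : LocallyIntegrable b volume)
    (f f' g : HaarPoly) :
    repeatedCommutator b (f + f') g = repeatedCommutator b f g + repeatedCommutator b f' g := by
  simp only [repeatedCommutator_eq, map_add, mulForm_add_left hb]
  ring

theorem repeatedCommutator_add_right {b : ℝ × ℝ → ℝ} (hb : LocallyIntegrable b volume)
    (f g g' : HaarPoly) :
    repeatedCommutator b f (g + g') = repeatedCommutator b f g + repeatedCommutator b f g' := by
  simp only [repeatedCommutator_eq, map_add, mulForm_add_right hb]
  ring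

theorem repeatedCommutator_smul_left (b : ℝ × ℝ → ℝ) (c : ℝ) (f g : HaarPoly) :
    repeatedCommutator b (c • f) g = c * repeatedCommutator b f g := by
  simp only [repeatedCommutator_eq, map_smul, mulForm_smul_left]
  ring

theorem repeatedCommutator_smul_right (b : ℝ × ℝ → ℝ) (c : ℝ) (f g : HaarPoly) :
    repeatedCommutator b f (c • g) = c * repeatedCommutator b f g := by
  simp only [repeatedCommutator_eq, map_smul, mulForm_smul_right]
  ring

/-! ### The shifts on single Haar functions -/

theorem shift₁_single {I : DyadicInterval} (hI : I.IsEven) (J : DyadicInterval) (c : ℝ) :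
    shift₁ (Finsupp.single (I, J) c) =
      Finsupp.single (I.plus, J) c - Finsupp.single (I.minus, J) c := by
  simp [shift₁, hI, smul_sub]

theorem shift₂_single (I : DyadicInterval) {J : DyadicInterval} (hJ : J.IsEven) (c : ℝ) :
    shift₂ (Finsupp.single (I, J) c) =
      Finsupp.single (I, J.plus) c - Finsupp.single (I, J.minus) c := by
  simp [shift₂, hJ, smul_sub]

theorem sign_plus (I : DyadicInterval) : I.plus.sign = 1 := by
  simp [DyadicInterval.sign, parent_plus]

theorem sign_minus (I : DyadicInterval) : I.minus.sign = -1 := by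
  simp [DyadicInterval.sign, parent_minus, (plus_ne_minus I I).symm]

theorem shiftAdj₁_single_plus {I : DyadicInterval} (hI : I.IsEven) (J : DyadicInterval) (c : ℝ) :
    shiftAdj₁ (Finsupp.single (I.plus, J) c) = Finsupp.single (I, J) c := by
  simp [shiftAdj₁, parent_plus, hI, sign_plus]

theorem shiftAdj₁_single_minus {I : DyadicInterval} (hI : I.IsEven) (J : DyadicInterval) (c : ℝ) :
    shiftAdj₁ (Finsupp.single (I.minus, J) c) = -Finsupp.single (I, J) c := by
  simp [shiftAdj₁, parent_minus, hI, sign_minus]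

theorem shiftAdj₂_single_plus (I : DyadicInterval) {J : DyadicInterval} (hJ : J.IsEven) (c : ℝ) :
    shiftAdj₂ (Finsupp.single (I, J.plus) c) = Finsupp.single (I, J) c := by
  simp [shiftAdj₂, parent_plus, hJ, sign_plus]

theorem shiftAdj₂_single_minus (I : DyadicInterval) {J : DyadicInterval} (hJ : J.IsEven) (c : ℝ) :
    shiftAdj₂ (Finsupp.single (I, J.minus) c) = -Finsupp.single (I, J) c := by
  simp [shiftAdj₂, parent_minus, hJ, sign_minus]

theorem shiftAdj₂_shift₁_shift₂_single {I J : DyadicInterval} (hI : I.IsEven) (hJ : J.IsEven)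
    (c : ℝ) :
    shiftAdj₂ (shift₁ (shift₂ (Finsupp.single (I, J) c))) =
      (2 : ℝ) • shift₁ (Finsupp.single (I, J) c) := by
  simp only [shift₂_single I hJ, shift₁_single hI, map_sub, shiftAdj₂_single_plus _ hJ,
    shiftAdj₂_single_minus _ hJ]
  module

theorem shiftAdj₁_shift₁_single {I : DyadicInterval} (hI : I.IsEven) (J : DyadicInterval) (c : ℝ) :
    shiftAdj₁ (shift₁ (Finsupp.single (I, J) c)) = (2 : ℝ) • Finsupp.single (I, J) c := by
  simp only [shift₁_single hI, map_sub, shiftAdj₁_single_plus hI, shiftAdj₁_single_minus hI]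
  module

theorem shiftAdj₂_shift₂_single (I : DyadicInterval) {J : DyadicInterval} (hJ : J.IsEven) (c : ℝ) :
    shiftAdj₂ (shift₂ (Finsupp.single (I, J) c)) = (2 : ℝ) • Finsupp.single (I, J) c := by
  simp only [shift₂_single I hJ, map_sub, shiftAdj₂_single_plus I hJ, shiftAdj₂_single_minus I hJ]
  module

theorem shiftAdj₁_shift₁_shift₂_single {I J : DyadicInterval} (hI : I.IsEven) (hJ : J.IsEven)
    (c : ℝ) :
    shiftAdj₁ (shift₁ (shift₂ (Finsupp.single (I, J) c))) =
      (2 : ℝ) • shift₂ (Finsupp.single (I, J) c) := by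
  simp only [shift₂_single I hJ, map_sub, shiftAdj₁_shift₁_single hI]
  module

theorem eval_shift₁_single (I J : DyadicInterval) :
    (shift₁ (Finsupp.single (I, J) 1)).eval = tensor I.shiftHaar J.haar := by
  by_cases hI : I.IsEven
  · rw [shift₁_single hI, HaarPoly.eval_sub, HaarPoly.eval_single, HaarPoly.eval_single]
    ext p
    simp [tensor, shiftHaar, hI, DyadicRect.haar, sub_mul]
  · ext p
    simp [shift₁, hI, HaarPoly.eval_zero, tensor, shiftHaar]

theorem eval_shift₂_single (I J : DyadicInterval) :
    (shift₂ (Finsupp.single (I, J) 1)).eval = tensor I.haar J.shiftHaar := by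
  by_cases hJ : J.IsEven
  · rw [shift₂_single I hJ, HaarPoly.eval_sub, HaarPoly.eval_single, HaarPoly.eval_single]
    ext p
    simp [tensor, shiftHaar, hJ, DyadicRect.haar, mul_sub]
  · ext p
    simp [shift₂, hJ, HaarPoly.eval_zero, tensor, shiftHaar]

theorem eval_shift₁_shift₂_single (I J : DyadicInterval) :
    (shift₁ (shift₂ (Finsupp.single (I, J) 1))).eval = tensor I.shiftHaar J.shiftHaar := by
  by_cases hJ : J.IsEven
  · rw [shift₂_single I hJ, map_sub, HaarPoly.eval_sub, eval_shift₁_single, eval_shift₁_single]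
    ext p
    simp [tensor, shiftHaar, hJ, mul_sub]
  · ext p
    simp [shift₂, hJ, HaarPoly.eval_zero, tensor, shiftHaar]

/-! ### The repeated commutator on Haar functions -/

/-- Since `T*T` is multiplication by 2 on even Haar functions, each adjoint that falls on `T₁T₂h`
undoes a shift at the cost of a factor 2. The four terms of the commutator are then the expansion of
a product of two one-variable factors. -/
theorem repeatedCommutator_single_eq_integral {b : ℝ × ℝ → ℝ} (hb : LocallyIntegrable b volume)
    {K J : DyadicInterval} (hK : K.IsEven) (hJ : J.IsEven) (I L : DyadicInterval) :
    repeatedCommutator b (Finsupp.single (I, L) 1) (shift₁ (shift₂ (Finsupp.single (K, J) 1))) =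
      ∫ p, b p * tensor ((2 : ℝ) • (I.haar * K.haar) - I.shiftHaar * K.shiftHaar)
        ((2 : ℝ) • (L.haar * J.haar) - L.shiftHaar * J.shiftHaar) p := by
  have key (f g : HaarPoly) := integrable_mulForm hb f g
  rw [repeatedCommutator_eq, shiftAdj₂_shift₁_shift₂_single hK hJ,
    shiftAdj₁_shift₁_shift₂_single hK hJ, map_smul, shiftAdj₁_shift₁_single hK, smul_smul]
  simp only [mulForm]
  rw [← integral_sub (key _ _) (key _ _), ← integral_sub (key _ _) (key _ _)]
  refine (integral_sub ((key _ _).sub (key _ _)) ((key _ _).sub (key _ _))).symm.trans ?_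
  congr 1
  ext p
  simp only [HaarPoly.eval_smul, HaarPoly.eval_single, eval_shift₁_single, eval_shift₂_single,
    eval_shift₁_shift₂_single, Pi.smul_apply, smul_eq_mul, tensor, Pi.sub_apply, Pi.mul_apply,
    DyadicRect.haar]
  ring

theorem two_smul_haar_sq_sub {K : DyadicInterval} (hK : K.IsEven) :
    (2 : ℝ) • (K.haar * K.haar) - K.shiftHaar * K.shiftHaar = 0 := by
  ext x
  simp [shiftHaar_mul_self hK]

theorem tensor_zero_left (v : ℝ → ℝ) : tensor 0 v = 0 := by ext p; simp [tensor]

theorem tensor_zero_right (u : ℝ → ℝ) : tensor u 0 = 0 := by ext p; simp [tensor]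

open Classical in
-- A shared side makes one of the two factors zero. Otherwise every term that contains a product of
-- shifted functions is orthogonal to `b`, and only `4 h_I h_K ⊗ h_L h_J` is left.
theorem SkipsScales.repeatedCommutator_single {b : ℝ × ℝ → ℝ} (hb : LocallyIntegrable b volume)
    (hs : SkipsScales b) {R : DyadicRect} (hR : R.1.IsEven ∧ R.2.IsEven) (S : DyadicRect) :
    repeatedCommutator b (Finsupp.single S 1) (shift₁ (shift₂ (Finsupp.single R 1))) =
      if S.1 ≠ R.1 ∧ S.2 ≠ R.2 then
        4 * mulForm b (Finsupp.single S 1) (Finsupp.single R 1) else 0 := by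
  obtain ⟨K, J⟩ := R
  obtain ⟨I, L⟩ := S
  obtain ⟨hK, hJ⟩ := hR
  rw [repeatedCommutator_single_eq_integral hb hK hJ]
  simp only
  by_cases h1 : I = K
  · subst h1
    simp [two_smul_haar_sq_sub hK, tensor_zero_left]
  by_cases h2 : L = J
  · subst h2
    simp [two_smul_haar_sq_sub hJ, tensor_zero_right]
  rw [if_pos ⟨h1, h2⟩]
  have hm := haar_mul_haar_mem_haarSpan h1
  have hn := shiftHaar_mul_shiftHaar_mem_oddHaarSpan h1
  have hm' := haar_mul_haar_mem_haarSpan h2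
  have hn' := shiftHaar_mul_shiftHaar_mem_oddHaarSpan h2
  have hann := (annihilator hb).sub_mem
    -- With `a`, `a'` the Haar products and `n`, `n'` the shifted ones, `(2a - n) ⊗ (2a' - n') = 4 a
    -- ⊗ a' - (2a ⊗ n' + n ⊗ (2a' - n'))`; `b` annihilates the bracket, as `n` and `n'` are odd.
    (hs.tensor_odd_right hb (haarSpan.smul_mem (2 : ℝ) hm) hn')
    ((annihilator hb).neg_mem (hs.tensor_odd_left hb hn (haarSpan.sub_mem
      (haarSpan.smul_mem (2 : ℝ) hm') (oddHaarSpan_le hn'))))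
  have hsplit : ∀ p, b p * tensor ((2 : ℝ) • (I.haar * K.haar) - I.shiftHaar * K.shiftHaar)
      ((2 : ℝ) • (L.haar * J.haar) - L.shiftHaar * J.shiftHaar) p =
      4 * (b p * HaarPoly.eval (Finsupp.single (I, L) 1) p *
        HaarPoly.eval (Finsupp.single (K, J) 1) p) -
      b p * (tensor ((2 : ℝ) • (I.haar * K.haar)) (L.shiftHaar * J.shiftHaar) -
        -tensor (I.shiftHaar * K.shiftHaar)
          ((2 : ℝ) • (L.haar * J.haar) - L.shiftHaar * J.shiftHaar)) p := fun p => by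
    simp only [HaarPoly.eval_single, Pi.smul_apply, smul_eq_mul, tensor, Pi.sub_apply, Pi.neg_apply,
      Pi.mul_apply, DyadicRect.haar]
    ring
  simp_rw [hsplit]
  rw [integral_sub ((integrable_mulForm hb _ _).const_mul 4)
    (integrable_mul_of_mem_boundedCompactFun hb hann.1), hann.2, integral_const_mul, sub_zero]
  rfl

open Classical in
theorem SkipsScales.repeatedCommutator_eq_mulForm {b : ℝ × ℝ → ℝ}
    (hb : LocallyIntegrable b volume) (hs : SkipsScales b) {R : DyadicRect}
    (hR : R.1.IsEven ∧ R.2.IsEven) (f : HaarPoly) :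
    repeatedCommutator b f (shift₁ (shift₂ (Finsupp.single R 1))) =
      4 * mulForm b ((f.filter fun S : DyadicRect => S.1 ≠ R.1).filter fun S : DyadicRect => S.2 ≠ R.2)
        (Finsupp.single R 1) := by
  induction f using Finsupp.induction_linear with
  | zero =>
    have h1 := repeatedCommutator_smul_left b 0 0 (shift₁ (shift₂ (Finsupp.single R 1)))
    have h2 := mulForm_smul_left b 0 0 (Finsupp.single R 1)
    rw [zero_smul, zero_mul] at h1 h2
    rw [Finsupp.filter_zero, Finsupp.filter_zero, h1, h2, mul_zero]
  | add f g hf hg =>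
    rw [repeatedCommutator_add_left hb, hf, hg, Finsupp.filter_add, Finsupp.filter_add,
      mulForm_add_left hb, mul_add]
  | single S c =>
    rw [← mul_one c, ← smul_eq_mul, ← Finsupp.smul_single, repeatedCommutator_smul_left,
      hs.repeatedCommutator_single hb hR, Finsupp.filter_smul, Finsupp.filter_smul,
      mulForm_smul_left]
    have h0 : mulForm b 0 (Finsupp.single R 1) = 0 := by simp [mulForm, HaarPoly.eval_zero]
    by_cases h1 : S.1 = R.1
    · rw [Finsupp.filter_single_of_neg _ (by simpa using h1), Finsupp.filter_zero, h0]
      simp [h1]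
    · rw [Finsupp.filter_single_of_pos (p := fun S : DyadicRect => S.1 ≠ R.1) h1]
      by_cases h2 : S.2 = R.2
      · rw [Finsupp.filter_single_of_neg _ (by simpa using h2), h0]
        simp [h2]
      · rw [Finsupp.filter_single_of_pos (p := fun S : DyadicRect => S.2 ≠ R.2) h2, if_pos ⟨h1, h2⟩]
        ring

/-! ### Test functions equal to one on a rectangle -/

open Classical in
-- Keeping the terms with first side `K` is the orthogonal projection onto `h_K` in `x`, with `y`
-- frozen. Integrability is carried along so that the integral splits in the induction.
theorem HaarPoly.eval_filter_fst (f : HaarPoly) (K : DyadicInterval) (x y : ℝ) :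
    Integrable (fun x' => f.eval (x', y) * K.haar x') ∧
    eval (f.filter fun S : DyadicRect => S.1 = K) (x, y) =
      K.haar x * ∫ x', f.eval (x', y) * K.haar x' := by
  induction f using Finsupp.induction_linear with
  | zero =>
    rw [Finsupp.filter_zero]
    simp [eval_zero]
  | add f g hf hg =>
    simp only [Finsupp.filter_add, eval_add, Pi.add_apply, add_mul]
    exact ⟨hf.1.add hg.1, by rw [integral_add hf.1 hg.1, hf.2, hg.2, mul_add]⟩
  | single S c =>
    have h (x' : ℝ) : HaarPoly.eval (Finsupp.single S c) (x', y) * K.haar x' =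
        c * S.2.haar y * (S.1.haar x' * K.haar x') := by
      simp only [eval_single, Pi.smul_apply, smul_eq_mul, DyadicRect.haar]; ring
    simp_rw [h]
    rw [integral_const_mul]
    by_cases hS : S.1 = K
    · refine ⟨?_, ?_⟩
      · rw [hS]
        simp_rw [haar_sq]
        exact (K.integrable_indicator _).const_mul _
      · rw [Finsupp.filter_single_of_pos (p := fun S : DyadicRect => S.1 = K) hS, hS, integral_haar_mul_self, eval_single]
        simp only [Pi.smul_apply, smul_eq_mul, DyadicRect.haar, hS]
        ring
    · have hi := integrable_and_integral_of_mem_haarSpan (haar_mul_haar_mem_haarSpan hS)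
      refine ⟨hi.1.const_mul _, ?_⟩
      rw [Finsupp.filter_single_of_neg (p := fun S : DyadicRect => S.1 = K) hS, integral_haar_mul_haar_of_ne hS, eval_zero]
      simp

open Classical in
theorem HaarPoly.eval_filter_snd (f : HaarPoly) (J : DyadicInterval) (x y : ℝ) :
    Integrable (fun y' => f.eval (x, y') * J.haar y') ∧
    eval (f.filter fun S : DyadicRect => S.2 = J) (x, y) =
      J.haar y * ∫ y', f.eval (x, y') * J.haar y' := by
  induction f using Finsupp.induction_linear with
  | zero =>
    rw [Finsupp.filter_zero]
    simp [eval_zero]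
  | add f g hf hg =>
    simp only [Finsupp.filter_add, eval_add, Pi.add_apply, add_mul]
    exact ⟨hf.1.add hg.1, by rw [integral_add hf.1 hg.1, hf.2, hg.2, mul_add]⟩
  | single S c =>
    have h (y' : ℝ) : HaarPoly.eval (Finsupp.single S c) (x, y') * J.haar y' =
        c * S.1.haar x * (S.2.haar y' * J.haar y') := by
      simp only [eval_single, Pi.smul_apply, smul_eq_mul, DyadicRect.haar]; ring
    simp_rw [h]
    rw [integral_const_mul]
    by_cases hS : S.2 = J
    · refine ⟨?_, ?_⟩
      · rw [hS]
        simp_rw [haar_sq]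
        exact (J.integrable_indicator _).const_mul _
      · rw [Finsupp.filter_single_of_pos (p := fun S : DyadicRect => S.2 = J) hS, hS, integral_haar_mul_self, eval_single]
        simp only [Pi.smul_apply, smul_eq_mul, DyadicRect.haar, hS]
        ring
    · have hi := integrable_and_integral_of_mem_haarSpan (haar_mul_haar_mem_haarSpan hS)
      refine ⟨hi.1.const_mul _, ?_⟩
      rw [Finsupp.filter_single_of_neg (p := fun S : DyadicRect => S.2 = J) hS, integral_haar_mul_haar_of_ne hS, eval_zero]
      simp

theorem integral_mul_haar_of_eq_one {u : ℝ → ℝ} {K : DyadicInterval}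
    (hu : ∀ x ∈ K.toSet, u x = 1) : ∫ x, u x * K.haar x = 0 := by
  rw [← K.integral_haar]
  congr 1
  ext x
  by_cases hx : x ∈ K.toSet
  · rw [hu x hx, one_mul]
  · rw [haar_of_not_mem hx, mul_zero]

open Classical in
-- For `y` in the second side of `R`, the slice of `f` is constant on the first side, so its
-- coefficient there is zero and the removed part vanishes. The conclusion has the form of the
-- hypothesis, which lets the second variable be filtered next.
theorem HaarPoly.eval_filter_fst_ne {f : HaarPoly} {R : DyadicRect}
    (hf : ∀ p ∈ R.toSet, f.eval p = 1) :
    ∀ p ∈ R.toSet, eval (f.filter fun S : DyadicRect => S.1 ≠ R.1) p = 1 := by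
  rintro ⟨x, y⟩ hp
  have h := congrArg (fun u => eval u (x, y)) (f.filter_add_filter_not fun S : DyadicRect => S.1 = R.1)
  simp only [eval_add, Pi.add_apply] at h
  rw [hf _ hp, (f.eval_filter_fst R.1 x y).2,
    integral_mul_haar_of_eq_one fun x' hx' => hf (x', y) ⟨hx', hp.2⟩, mul_zero, zero_add] at h
  exact h

open Classical in
theorem HaarPoly.eval_filter_snd_ne {f : HaarPoly} {R : DyadicRect}
    (hf : ∀ p ∈ R.toSet, f.eval p = 1) :
    ∀ p ∈ R.toSet, eval (f.filter fun S : DyadicRect => S.2 ≠ R.2) p = 1 := by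
  rintro ⟨x, y⟩ hp
  have h := congrArg (fun u => eval u (x, y)) (f.filter_add_filter_not fun S : DyadicRect => S.2 = R.2)
  simp only [eval_add, Pi.add_apply] at h
  rw [hf _ hp, (f.eval_filter_snd R.2 x y).2,
    integral_mul_haar_of_eq_one fun y' hy' => hf (x, y') ⟨hp.1, hy'⟩, mul_zero, zero_add] at h
  exact h

theorem mulForm_single_of_eval_eq_one (b : ℝ × ℝ → ℝ) {f : HaarPoly} {R : DyadicRect}
    (hf : ∀ p ∈ R.toSet, f.eval p = 1) :
    mulForm b f (Finsupp.single R 1) = haarCoeff b R := by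
  unfold mulForm haarCoeff
  congr 1
  ext p
  rw [HaarPoly.eval_single, one_smul]
  by_cases hp : p ∈ R.toSet
  · rw [hf p hp, mul_one]
  · have : R.haar p = 0 := by
      rw [DyadicRect.toSet, Set.mem_prod, not_and_or] at hp
      rcases hp with h | h <;> simp [DyadicRect.haar, haar_of_not_mem h]
    rw [this, mul_zero, mul_zero]

/-- If a test function is one on an even rectangle `R`, the repeated commutator recovers
the Haar coefficient of `b` at `R`. -/
theorem SkipsScales.repeatedCommutator_eq_haarCoeff {b : ℝ × ℝ → ℝ}
    (hb : LocallyIntegrable b volume) (hs : SkipsScales b) {R : DyadicRect}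
    (hR : R.1.IsEven ∧ R.2.IsEven) {f : HaarPoly} (hf : ∀ p ∈ R.toSet, f.eval p = 1) :
    repeatedCommutator b f (shift₁ (shift₂ (Finsupp.single R 1))) = 4 * haarCoeff b R := by
  rw [hs.repeatedCommutator_eq_mulForm hb hR, mulForm_single_of_eval_eq_one b
    (HaarPoly.eval_filter_snd_ne (HaarPoly.eval_filter_fst_ne hf))]

/-! ### Dyadic open sets as unions of grid cells -/

/-- The union of the dyadic squares of side `2⁻ᵐ` with positions in `D`. -/
def gridUnion (m : ℤ) (D : Finset (ℤ × ℤ)) : Set (ℝ × ℝ) :=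
  {p | (⌊p.1 * 2 ^ m⌋, ⌊p.2 * 2 ^ m⌋) ∈ D}

theorem mem_toSet_iff_mem_Ico {I : DyadicInterval} {m : ℤ} (h : I.scale ≤ m) (x : ℝ) :
    x ∈ I.toSet ↔ ⌊x * 2 ^ m⌋ ∈ Finset.Ico (I.pos * 2 ^ (m - I.scale).toNat)
      ((I.pos + 1) * 2 ^ (m - I.scale).toNat) := by
  have hm : m = I.scale + ((m - I.scale).toNat : ℤ) := by omega
  have hpos : (0 : ℤ) < 2 ^ (m - I.scale).toNat := by positivity
  rw [mem_toSet_iff, floor_mul_two_zpow_div x I.scale (m - I.scale).toNat, ← hm, Finset.mem_Ico,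
    ← Int.le_ediv_iff_mul_le hpos, ← Int.ediv_lt_iff_lt_mul hpos]
  omega

theorem exists_gridUnion_eq {U : Set (ℝ × ℝ)} (hU : IsDyadicOpen U) :
    ∃ m D, U = gridUnion m D := by
  classical
  obtain ⟨s, rfl⟩ := hU
  -- `m` is at least as fine as every side, so each rectangle is a block of grid cells.
  obtain ⟨m, hm⟩ := (s.image fun R => max R.1.scale R.2.scale).bddAbove
  have hm' : ∀ R ∈ s, R.1.scale ≤ m ∧ R.2.scale ≤ m := fun R hR =>
    max_le_iff.1 (hm (Finset.mem_coe.2 (Finset.mem_image_of_mem _ hR)))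
  refine ⟨m, s.biUnion fun R =>
    Finset.Ico (R.1.pos * 2 ^ (m - R.1.scale).toNat)
      ((R.1.pos + 1) * 2 ^ (m - R.1.scale).toNat) ×ˢ
    Finset.Ico (R.2.pos * 2 ^ (m - R.2.scale).toNat)
      ((R.2.pos + 1) * 2 ^ (m - R.2.scale).toNat), ?_⟩
  ext p
  simp only [Set.mem_iUnion, gridUnion, Set.mem_ofPred_eq, Finset.mem_biUnion, Finset.mem_product,
    exists_prop, DyadicRect.toSet, Set.mem_prod]
  refine exists_congr fun R => and_congr_right fun hR => ?_
  rw [mem_toSet_iff_mem_Ico (hm' R hR).1, mem_toSet_iff_mem_Ico (hm' R hR).2]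

theorem gridUnion_eq_biUnion (m : ℤ) (D : Finset (ℤ × ℤ)) :
    gridUnion m D = ⋃ q ∈ D, DyadicRect.toSet (⟨m, q.1⟩, ⟨m, q.2⟩) := by
  ext p
  simp [gridUnion, DyadicRect.toSet, mem_toSet_iff]

theorem measurableSet_rect (R : DyadicRect) : MeasurableSet R.toSet :=
  R.1.measurableSet_toSet.prod R.2.measurableSet_toSet

theorem volume_rect (R : DyadicRect) :
    volume R.toSet = ENNReal.ofReal (R.1.length * R.2.length) := by
  rw [DyadicRect.toSet, Measure.volume_eq_prod, Measure.prod_prod, volume_toSet, volume_toSet,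
    ENNReal.ofReal_mul R.1.length_pos.le]

theorem measurableSet_gridUnion (m : ℤ) (D : Finset (ℤ × ℤ)) :
    MeasurableSet (gridUnion m D) := by
  rw [gridUnion_eq_biUnion]
  exact D.measurableSet_biUnion fun _ _ => measurableSet_rect _

theorem volume_gridUnion (m : ℤ) (D : Finset (ℤ × ℤ)) :
    volume (gridUnion m D) = D.card * ENNReal.ofReal (2 ^ (-m) * 2 ^ (-m)) := by
  rw [gridUnion_eq_biUnion, measure_biUnion_finset _ fun _ _ => measurableSet_rect _]
  · simp only [volume_rect, length]
    rw [Finset.sum_const, nsmul_eq_mul]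
  · intro q _ q' _ hne
    refine Set.disjoint_left.2 fun p hp hp' => hne ?_
    simp only [DyadicRect.toSet, Set.mem_prod, mem_toSet_iff] at hp hp'
    exact Prod.ext (hp.1.symm.trans hp'.1) (hp.2.symm.trans hp'.2)

theorem sum_tensor_indicator (m : ℤ) (D : Finset (ℤ × ℤ)) :
    ∑ q ∈ D, tensor ((toSet ⟨m, q.1⟩).indicator 1) ((toSet ⟨m, q.2⟩).indicator 1) =
      (gridUnion m D).indicator 1 := by
  classical
  ext p
  have h (q : ℤ × ℤ) :
      tensor ((toSet ⟨m, q.1⟩).indicator 1) ((toSet ⟨m, q.2⟩).indicator 1) p =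
        if (⌊p.1 * 2 ^ m⌋, ⌊p.2 * 2 ^ m⌋) = q then 1 else 0 := by
    simp only [tensor, Set.indicator_apply, mem_toSet_iff, Prod.ext_iff, Pi.one_apply]
    by_cases h1 : ⌊p.1 * 2 ^ m⌋ = q.1 <;> by_cases h2 : ⌊p.2 * 2 ^ m⌋ = q.2 <;> simp [h1, h2]
  rw [Finset.sum_apply]
  simp_rw [h]
  rw [Finset.sum_ite_eq]
  simp [Set.indicator_apply, gridUnion]

/-- The shift of grid positions by `2ⁿ` away from the origin. -/
def farShift (n : ℕ) (i : ℤ) : ℤ := if 0 ≤ i then i + 2 ^ n else i - 2 ^ n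

theorem farShift_injective (n : ℕ) : Function.Injective (farShift n) := by
  intro i j h
  have : (0 : ℤ) < 2 ^ n := by positivity
  unfold farShift at h
  split_ifs at h <;> omega

theorem le_abs_farShift (n : ℕ) (i : ℤ) : 2 ^ n ≤ |farShift n i| := by
  have : (0 : ℤ) < 2 ^ n := by positivity
  unfold farShift
  split_ifs
  · rw [abs_of_nonneg (by omega)]; omega
  · rw [abs_of_neg (by omega)]; omega

/-- Dyadic intervals on opposite sides of the origin have no common ancestor, which is why the shift
moves away from the origin. After `n + 1` generations both positions become 0, or both become -1. -/
theorem indicator_sub_farShift_mem_haarSpan (m : ℤ) {n : ℕ} {i : ℤ} (h : |i| < 2 ^ n) :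
    (toSet ⟨m, i⟩).indicator 1 - (toSet ⟨m, farShift n i⟩).indicator 1 ∈ haarSpan := by
  refine indicator_sub_indicator_mem_haarSpan (n + 1) m i _ ?_
  have hpos : (0 : ℤ) < 2 ^ n := by positivity
  obtain ⟨h1, h2⟩ := abs_lt.1 h
  rw [pow_succ]
  unfold farShift
  split_ifs with h0
  · rw [Int.ediv_eq_zero_of_lt h0 (by omega), Int.ediv_eq_zero_of_lt (by omega) (by omega)]
  · have key {a : ℤ} (ha : a < 0) (ha' : -(2 ^ n * 2) ≤ a) : a / (2 ^ n * 2) = -1 :=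
      le_antisymm (Int.lt_add_one_iff.1 (Int.ediv_lt_of_lt_mul (by omega) (by omega)))
        ((Int.le_ediv_iff_mul_le (by omega)).2 (by omega))
    rw [key (by omega) (by omega), key (by omega) (by omega)]

theorem eLpNorm_indicator_gridUnion_le {m : ℤ} {D D' : Finset (ℤ × ℤ)} (h : D'.card ≤ D.card) :
    eLpNorm ((gridUnion m D').indicator (1 : ℝ × ℝ → ℝ)) 2 volume ≤
      volume (gridUnion m D) ^ (1 / 2 : ℝ) := by
  have := eLpNorm_indicator_const (c := (1 : ℝ)) (p := 2) (μ := (volume : Measure (ℝ × ℝ)))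
    (measurableSet_gridUnion m D') two_ne_zero ENNReal.ofNat_ne_top
  simp only [enorm_one, one_mul, ENNReal.toReal_ofNat] at this
  refine this.trans_le (ENNReal.rpow_le_rpow ?_ (by norm_num))
  rw [volume_gridUnion, volume_gridUnion]
  gcongr

/-- A dyadic open set carries a test function that equals one on it and has comparable norm. -/
theorem exists_haarPoly_eq_one {U : Set (ℝ × ℝ)} (hU : IsDyadicOpen U) :
    ∃ f : HaarPoly, (∀ p ∈ U, f.eval p = 1) ∧
      eLpNorm f.eval 2 volume ≤ 4 * volume U ^ (1 / 2 : ℝ) := by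
  classical
  obtain ⟨m, D, rfl⟩ := exists_gridUnion_eq hU
  obtain ⟨N, hN⟩ := (D.image fun q => max |q.1| |q.2|).bddAbove
  -- With `2 ^ n` above all positions of cells in `D`, a shifted cell cannot meet the original set.
  set n := N.toNat
  have hlt : ∀ q ∈ D, |q.1| < 2 ^ n ∧ |q.2| < 2 ^ n := fun q hq => by
    have h1 := max_le_iff.1 (hN (Finset.mem_coe.2 (Finset.mem_image_of_mem _ hq)))
    have h2 : (n : ℤ) < 2 ^ n := by exact_mod_cast Nat.lt_two_pow_self
    have h3 : N ≤ n := Int.self_le_toNat N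
    exact ⟨by omega, by omega⟩
  set σ := farShift n
  have hσ : Function.Injective σ := farShift_injective n
  have hid : Function.Injective (id : ℤ → ℤ) := Function.injective_id
  set e : ℤ → ℝ → ℝ := fun i => (toSet ⟨m, i⟩).indicator 1 with he
  -- Each cell is balanced in both variables at once. Of the four resulting cells only the original
  -- one touches the set, and injectivity of `σ` keeps the copies distinct.
  have hmem : ∑ q ∈ D, tensor (e q.1 - e (σ q.1)) (e q.2 - e (σ q.2)) ∈
      LinearMap.range HaarPoly.evalₗ :=
    Submodule.sum_mem _ fun q hq => HaarPoly.exists_eval_eq_tensor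
      (indicator_sub_farShift_mem_haarSpan m (hlt q hq).1)
      (indicator_sub_farShift_mem_haarSpan m (hlt q hq).2)
  obtain ⟨f, hf⟩ := hmem
  rw [HaarPoly.evalₗ_apply] at hf
  have himg (φ ψ : ℤ → ℤ) (hφ : φ.Injective) (hψ : ψ.Injective) :
      ∑ q ∈ D, tensor (e (φ q.1)) (e (ψ q.2)) =
        (gridUnion m (D.image (Prod.map φ ψ))).indicator 1 := by
    rw [← sum_tensor_indicator, Finset.sum_image ((hφ.prodMap hψ).injOn)]
    rfl
  have hcard (φ ψ : ℤ → ℤ) : (D.image (Prod.map φ ψ)).card ≤ D.card := Finset.card_image_le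
  have hexp : f.eval = (gridUnion m D).indicator 1 -
      (gridUnion m (D.image (Prod.map σ id))).indicator 1 -
      ((gridUnion m (D.image (Prod.map id σ))).indicator 1 -
      (gridUnion m (D.image (Prod.map σ σ))).indicator 1) := by
    rw [hf, ← himg σ id hσ hid, ← himg id σ hid hσ, ← himg σ σ hσ hσ, ← sum_tensor_indicator,
      ← Finset.sum_sub_distrib, ← Finset.sum_sub_distrib, ← Finset.sum_sub_distrib]
    refine Finset.sum_congr rfl fun q _ => ?_
    ext p
    simp only [tensor, Pi.sub_apply, id_eq, he]
    ring
  refine ⟨f, fun p hp => ?_, ?_⟩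
  · have hp' := hlt _ hp
    have h1 (ψ : ℤ → ℤ) : p ∉ gridUnion m (D.image (Prod.map σ ψ)) := fun h => by
      obtain ⟨q, -, hq⟩ := Finset.mem_image.1 h
      have := le_abs_farShift n q.1
      rw [show farShift n q.1 = _ from congrArg Prod.fst hq] at this
      exact absurd hp'.1 (not_lt.2 this)
    have h2 : p ∉ gridUnion m (D.image (Prod.map id σ)) := fun h => by
      obtain ⟨q, -, hq⟩ := Finset.mem_image.1 h
      have := le_abs_farShift n q.2
      rw [show farShift n q.2 = _ from congrArg Prod.snd hq] at this
      exact absurd hp'.2 (not_lt.2 this)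
    simp [hexp, hp, h1, h2]
  · have hmeas (D' : Finset (ℤ × ℤ)) :
        AEStronglyMeasurable ((gridUnion m D').indicator (1 : ℝ × ℝ → ℝ)) volume :=
      (measurable_one.indicator (measurableSet_gridUnion m D')).aestronglyMeasurable
    have hn {D' : Finset (ℤ × ℤ)} (h : D'.card ≤ D.card) :=
      eLpNorm_indicator_gridUnion_le (m := m) h
    rw [hexp]
    -- The constant 4 counts the four indicators, each of a set no larger in measure than the
    -- original.
    refine (eLpNorm_sub_le ((hmeas _).sub (hmeas _)) ((hmeas _).sub (hmeas _)) one_le_two).trans ?_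
    refine (add_le_add (eLpNorm_sub_le (hmeas _) (hmeas _) one_le_two)
      (eLpNorm_sub_le (hmeas _) (hmeas _) one_le_two)).trans ?_
    refine (add_le_add (add_le_add (hn le_rfl) (hn (hcard _ _)))
      (add_le_add (hn (hcard _ _)) (hn (hcard _ _)))).trans (le_of_eq ?_)
    ring

/-! ### The energy estimate -/

/-- Homogeneity. Dividing by positive upper bounds, not by the norms themselves, avoids a case of
zero norm. -/
theorem ofReal_abs_repeatedCommutator_le (b : ℝ × ℝ → ℝ) {f g : HaarPoly} {α β : ℝ}
    (hα : 0 < α) (hβ : 0 < β) (hf : eLpNorm f.eval 2 volume ≤ ENNReal.ofReal α)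
    (hg : eLpNorm g.eval 2 volume ≤ ENNReal.ofReal β) :
    ENNReal.ofReal |repeatedCommutator b f g| ≤ commutatorNorm b * ENNReal.ofReal (α * β) := by
  have hnorm {h : HaarPoly} {γ : ℝ} (hγ : 0 < γ) (hh : eLpNorm h.eval 2 volume ≤ ENNReal.ofReal γ) :
      eLpNorm (HaarPoly.eval (γ⁻¹ • h)) 2 volume ≤ 1 := by
    rw [HaarPoly.eval_smul, eLpNorm_const_smul, Real.enorm_of_nonneg (inv_nonneg.2 hγ.le)]
    refine (mul_le_mul_right hh _).trans (le_of_eq ?_)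
    rw [← ENNReal.ofReal_mul (inv_nonneg.2 hγ.le), inv_mul_cancel₀ hγ.ne', ENNReal.ofReal_one]
  have key : ENNReal.ofReal |repeatedCommutator b (α⁻¹ • f) (β⁻¹ • g)| ≤ commutatorNorm b :=
    le_iSup₂_of_le (α⁻¹ • f) (β⁻¹ • g) (le_iSup₂_of_le (hnorm hα hf) (hnorm hβ hg) le_rfl)
  refine le_trans (le_of_eq ?_) (mul_le_mul_left key _)
  rw [← ENNReal.ofReal_mul (abs_nonneg _), repeatedCommutator_smul_left,
    repeatedCommutator_smul_right, abs_mul, abs_mul, abs_of_pos (inv_pos.2 hα),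
    abs_of_pos (inv_pos.2 hβ)]
  congr 1
  field_simp

theorem repeatedCommutator_sum_right {b : ℝ × ℝ → ℝ} (hb : LocallyIntegrable b volume)
    (f : HaarPoly) (t : Finset DyadicRect) (g : DyadicRect → HaarPoly) :
    repeatedCommutator b f (∑ R ∈ t, g R) = ∑ R ∈ t, repeatedCommutator b f (g R) :=
  map_sum (IsLinearMap.mk' (repeatedCommutator b f)
    ⟨repeatedCommutator_add_right hb f, fun c g => repeatedCommutator_smul_right b c f g⟩) g t

/-- Duality: one pair, with `f = 1` on `U` and the shifted `g = ∑ (b, h_R) h_R`, makes the form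
equal to four times the energy, while the norm of the second function is only of the order of its
square root. -/
theorem SkipsScales.ofReal_sum_haarCoeff_sq_le {b : ℝ × ℝ → ℝ} (hb : LocallyIntegrable b volume)
    (hs : SkipsScales b) {U : Set (ℝ × ℝ)} (hU : IsDyadicOpen U) (t : Finset DyadicRect)
    (ht : ∀ R ∈ t, R.toSet ⊆ U) :
    ENNReal.ofReal (∑ R ∈ t, haarCoeff b R ^ 2) ≤ 4 * commutatorNorm b ^ 2 * volume U := by
  classical
  set A := ∑ R ∈ t, haarCoeff b R ^ 2 with hA
  have hA0 : 0 ≤ A := Finset.sum_nonneg fun R _ => sq_nonneg (haarCoeff b R)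
  rcases hA0.eq_or_lt with h0 | hApos
  · rw [← h0, ENNReal.ofReal_zero]
    exact zero_le
  obtain ⟨f, hf, hfn⟩ := exists_haarPoly_eq_one hU
  set g : HaarPoly := ∑ R ∈ t, Finsupp.single R (haarCoeff b R) with hg
  have hgapply : ∀ R ∈ t, g R = haarCoeff b R := fun R hR => by
    rw [hg, Finsupp.finsetSum_apply]
    simp only [Finsupp.single_apply]
    rw [Finset.sum_ite_eq', if_pos hR]
  have hadj : shiftAdj₂ (shiftAdj₁ (shift₁ (shift₂ g))) = (4 : ℝ) • g := by
    rw [hg]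
    simp only [map_sum, Finset.smul_sum]
    refine Finset.sum_congr rfl fun R _ => ?_
    -- A rectangle of `t` may be odd, but then its coefficient is zero; the others are even and `T*T
    -- = 2` applies in each variable.
    by_cases hR : haarCoeff b R = 0
    · simp [hR]
    · rw [shiftAdj₁_shift₁_shift₂_single (hs R hR).1 (hs R hR).2, map_smul,
        shiftAdj₂_shift₂_single _ (hs R hR).2, smul_smul]
      norm_num
  have hgg : HaarPoly.pair g g = A := by
    rw [HaarPoly.pair_eq_apply]
    conv_lhs => rw [hg]
    rw [map_sum]
    refine Finset.sum_congr rfl fun R hR => ?_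
    rw [Finsupp.linearCombination_single, ← hg, hgapply R hR, smul_eq_mul, sq]
  have hpair : HaarPoly.pair (shift₁ (shift₂ g)) (shift₁ (shift₂ g)) = 4 * A := by
    rw [pair_shift₁, pair_shift₂, hadj, HaarPoly.pair_comm, HaarPoly.pair_eq_apply, map_smul,
      ← HaarPoly.pair_eq_apply, hgg, smul_eq_mul]
  have hC : repeatedCommutator b f (shift₁ (shift₂ g)) = 4 * A := by
    rw [hg, map_sum, map_sum, repeatedCommutator_sum_right hb, hA, Finset.mul_sum]
    refine Finset.sum_congr rfl fun R hR => ?_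
    rw [← mul_one (haarCoeff b R), ← smul_eq_mul, ← Finsupp.smul_single, map_smul, map_smul,
      repeatedCommutator_smul_right, smul_eq_mul, mul_one]
    by_cases h : haarCoeff b R = 0
    · simp [h]
    · rw [hs.repeatedCommutator_eq_haarCoeff hb (hs R h) fun p hp => hf p (ht R hR hp)]
      ring
  have hUtop : volume U ≠ ∞ := by
    obtain ⟨m, D, rfl⟩ := exists_gridUnion_eq hU
    rw [volume_gridUnion]
    exact ENNReal.mul_ne_top (ENNReal.natCast_ne_top _) ENNReal.ofReal_ne_top
  have hUpos : volume U ≠ 0 := by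
    obtain ⟨R, hR⟩ := Finset.nonempty_of_sum_ne_zero hApos.ne'
    refine (lt_of_lt_of_le ?_ (measure_mono (ht R hR))).ne'
    rw [volume_rect]
    exact ENNReal.ofReal_pos.2 (mul_pos R.1.length_pos R.2.length_pos)
  obtain ⟨u, hu, hUu⟩ : ∃ u : ℝ, 0 < u ∧ volume U = ENNReal.ofReal u :=
    ⟨_, ENNReal.toReal_pos hUpos hUtop, (ENNReal.ofReal_toReal hUtop).symm⟩
  have hsu := Real.sqrt_pos.2 hu
  have hsA := Real.sqrt_pos.2 hApos
  have hfn' : eLpNorm f.eval 2 volume ≤ ENNReal.ofReal (4 * Real.sqrt u) := by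
    refine hfn.trans (le_of_eq ?_)
    rw [hUu, ENNReal.ofReal_rpow_of_pos hu, ← Real.sqrt_eq_rpow, ENNReal.ofReal_mul (by norm_num),
      ENNReal.ofReal_ofNat]
  have hgn : eLpNorm (HaarPoly.eval (shift₁ (shift₂ g))) 2 volume ≤
      ENNReal.ofReal (2 * Real.sqrt A) := by
    rw [HaarPoly.eLpNorm_eval, hpair, Real.sqrt_mul (by norm_num),
      show Real.sqrt 4 = 2 by rw [show (4 : ℝ) = 2 ^ 2 by norm_num]; exact Real.sqrt_sq two_pos.le]
  have hmain := ofReal_abs_repeatedCommutator_le b (by positivity) (by positivity) hfn' hgn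
  -- Both sides are written with the factor `4√A`, which is finite and nonzero and so cancels even
  -- if the commutator norm is infinite. There remains `√A ≤ ‖[T₂,[T₁,b]]‖ · 2√u`, to be squared.
  rw [hC, abs_of_pos (by positivity),
    show 4 * A = Real.sqrt A * (4 * Real.sqrt A) by
      linear_combination (-4) * Real.mul_self_sqrt hApos.le,
    show 4 * Real.sqrt u * (2 * Real.sqrt A) = 2 * Real.sqrt u * (4 * Real.sqrt A) by ring,
    ENNReal.ofReal_mul hsA.le, ENNReal.ofReal_mul (p := 2 * Real.sqrt u) (by positivity),
    ← mul_assoc,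
    ENNReal.mul_le_mul_iff_left (ENNReal.ofReal_pos.2 (by positivity)).ne' ENNReal.ofReal_ne_top]
    at hmain
  calc ENNReal.ofReal A = ENNReal.ofReal (Real.sqrt A) ^ 2 := by
        rw [← ENNReal.ofReal_pow hsA.le, Real.sq_sqrt hApos.le]
    _ ≤ (commutatorNorm b * ENNReal.ofReal (2 * Real.sqrt u)) ^ 2 := by gcongr
    _ = 4 * commutatorNorm b ^ 2 * volume U := by
        rw [mul_pow, ← ENNReal.ofReal_pow (by positivity), mul_pow, Real.sq_sqrt hu.le,
          ENNReal.ofReal_mul (by norm_num), hUu]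
        norm_num
        ring

theorem SkipsScales.haarEnergy_le {b : ℝ × ℝ → ℝ} (hb : LocallyIntegrable b volume)
    (hs : SkipsScales b) {U : Set (ℝ × ℝ)} (hU : IsDyadicOpen U) :
    haarEnergy b U ≤ 4 * commutatorNorm b ^ 2 * volume U := by
  rw [haarEnergy, ENNReal.tsum_eq_iSup_sum]
  refine iSup_le fun t => ?_
  rw [← ENNReal.ofReal_sum_of_nonneg fun R _ => sq_nonneg _]
  refine le_trans (le_of_eq ?_) (hs.ofReal_sum_haarCoeff_sq_le hb hU
    (t.map (Function.Embedding.subtype _)) fun R hR => ?_)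
  · rw [Finset.sum_map]
    rfl
  · obtain ⟨S, -, rfl⟩ := Finset.mem_map.1 hR
    exact S.2

end

theorem theorem9p2 :
    ∃ C₁ : ℝ≥0, ∀ b : ℝ × ℝ → ℝ, LocallyIntegrable b volume → SkipsScales b →
      (∀ U₀ : Set (ℝ × ℝ), IsDyadicOpen U₀ →
        haarEnergy b U₀ ≤ (C₁ : ℝ≥0∞) * commutatorNorm b ^ 2 * volume U₀) ∧
      changFeffermanNorm b ^ 2 ≤ (C₁ : ℝ≥0∞) * commutatorNorm b ^ 2 := by
  -- The value 4 is `(4 · 2 / 4)²`: the norm factors 4 of `f` and 2 of `T₁T₂g`, over the factor 4 of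
  -- the form.
  refine ⟨4, fun b hb hs => ⟨fun U hU => ?_, ?_⟩⟩
  · exact_mod_cast hs.haarEnergy_le hb hU
  · rw [changFeffermanNorm, ← ENNReal.rpow_natCast, ← ENNReal.rpow_mul]
    norm_num
    intro U hU _
    exact ENNReal.div_le_of_le_mul (hs.haarEnergy_le hb hU)
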